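/- Let $\ell,\rho_1,\rho_2,\rho_3,\kappa,b,\delta,\beta,\tau>0$, and let $\|\cdot\|$ be the norm of $L^2=L^2(0,\ell)$. Let $L^2_*$ be the subspace of zero-mean functions in $L^2$, let $H^1_0=H^1_0(0,\ell)$, and let $H^1_*=H^1(0,\ell)\cap L^2_*$. Put $$\mu(s)=\frac{\beta^2}{\tau^2}\,e^{-s\beta/\tau}\quad(s>0),\qquad \mathcal M=L^2\big((0,\infty),\mu(s)\,ds;H^1_0\big),\qquad \|\eta\|_{\mathcal M}^2=\int_0^\infty\mu(s)\|\eta_x(s)\|^2\,ds ,$$ so that $\mu=-g'$ for the exponential memory kernel $g(s)=\frac{\beta}{\tau}e^{-s\beta/\tau}$. *Timoshenko–Gurtin–Pipkin system.* Let $\mathcal H=H_0^1\times L^2\times H^1_*\times L^2_*\times L^2\times\mathcal M$, with the norm $$\|(\varphi,\tilde\varphi,\psi,\tilde\psi,\theta,\eta)\|_{\mathcal H}^2=\kappa\|\varphi_x+\psi\|^2+\rho_1\|\tilde\varphi\|^2+b\|\psi_x\|^2+\rho_2\|\tilde\psi\|^2+\rho_3\|\theta\|^2+\tfrac1\beta\|\eta\|_{\mathcal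 M}^2 .$$ Let $T\eta=-D\eta$, where $D$ is the weak derivative in $s\in(0,\infty)$, with domain $\mathcal D(T)=\{\eta\in\mathcal M: D\eta\in\mathcal M,\ \lim_{s\to0}\|\eta_x(s)\|=0\}$. Let $S(t)$ be the $C_0$-semigroup on $\mathcal H$ generated by $$\mathbb A(\varphi,\tilde\varphi,\psi,\tilde\psi,\theta,\eta)=\Big(\tilde\varphi,\ \tfrac{\kappa}{\rho_1}(\varphi_x+\psi)_x,\ \tilde\psi,\ \tfrac b{\rho_2}\psi_{xx}-\tfrac\kappa{\rho_2}(\varphi_x+\psi)-\tfrac\delta{\rho_2}\theta_x,\ \tfrac1{\beta\rho_3}\int_0^\infty\mu(s)\eta_{xx}(s)\,ds-\tfrac\delta{\rho_3}\tilde\psi_x,\ T\eta+\theta\Big),$$ with domain given by $\varphi\in H^2$, $\tilde\varphi\in H^1_0$, $\psi_x\in H^1_0$, $\tilde\psi\in H^1_*$, $\theta\in H^1_0$, $\eta\in\mathcal D(T)$ and $\int_0^\infty\mu(s)\eta(s)\,ds\in H^2$. The integral of $\mu\eta_{xx}$ means $\big(\int_0^\infty\mu(s)\eta(s)\,ds\big)_{xx}$.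 *Timoshenko–Cattaneo system.* Let $\hat{\mathcal H}=H_0^1\times L^2\times H^1_*\times L^2_*\times L^2\times L^2$, with the norm $$\|(\varphi,\tilde\varphi,\psi,\tilde\psi,\theta,q)\|_{\hat{\mathcal H}}^2=\kappa\|\varphi_x+\psi\|^2+\rho_1\|\tilde\varphi\|^2+b\|\psi_x\|^2+\rho_2\|\tilde\psi\|^2+\rho_3\|\theta\|^2+\tau\|q\|^2 .$$ Let $\hat S(t)$ be the $C_0$-semigroup on $\hat{\mathcal H}$ associated with $$\rho_1\varphi_{tt}-\kappa(\varphi_x+\psi)_x=0,\quad \rho_2\psi_{tt}-b\psi_{xx}+\kappa(\varphi_x+\psi)+\delta\theta_x=0,\quad \rho_3\theta_t+q_x+\delta\psi_{tx}=0,\quad \tau q_t+\beta q+\theta_x=0 .$$ That is, its generator maps $(\varphi,\tilde\varphi,\psi,\tilde\psi,\theta,q)$ to a vector whose first four components are those of $\mathbb A$ and whose last two are $-\frac1{\rho_3}q_x-\frac\delta{\rho_3}\tilde\psi_x$ and $-\frac\beta\tau q-\frac1\tau\theta_x$. Its domain is given by $\varphi\in H^2$, $\tilde\varphi\in H^1_0$,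 $\psi_x\in H^1_0$, $\tilde\psi\in H^1_*$, $\theta\in H^1_0$, $q\in H^1$. A semigroup $U(t)$ on a normed space $X$ is called exponentially stable if there are $\omega>0$ and $C\ge1$ such that $\|U(t)z\|_X\le Ce^{-\omega t}\|z\|_X$ for all $z\in X$ and $t\ge0$. **Proposition.** If $\hat S(t)$ is exponentially stable on $\hat{\mathcal H}$, then $S(t)$ is exponentially stable on $\mathcal H$. -/

import Mathlib

open MeasureTheory Set Filter Topology
open scoped NNReal ENNReal ContDiff

noncomputable section

namespace Timoshenko

/-! ### Strongly continuous semigroups -/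

section Semigroups

variable {X : Type*} [NormedAddCommGroup X] [NormedSpace ℝ X]

/-- `S` is a strongly continuous one-parameter semigroup of bounded linear operators. -/
structure IsC0Semigroup (S : ℝ≥0 → X →L[ℝ] X) : Prop where
  zero : S 0 = ContinuousLinearMap.id ℝ X
  add : ∀ s t, S (s + t) = (S s).comp (S t)
  tendsto_zero : ∀ x, Tendsto (fun t => S t x) (𝓝 0) (𝓝 x)

/-- The operator with graph `G` is the infinitesimal generator of `S`: the right derivative at `0`
of `t ↦ S t x` exists and equals `y` if and only if `x` is in the domain and is mapped to `y`. -/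
def IsGenerator (S : ℝ≥0 → X →L[ℝ] X) (G : X → X → Prop) : Prop :=
  ∀ x y, G x y ↔ Tendsto (fun h : ℝ≥0 => (h : ℝ)⁻¹ • (S h x - x)) (𝓝[>] 0) (𝓝 y)

/-- Exponential stability of `S` with respect to the norm `N`. -/
def ExpStable (N : X → ℝ) (S : ℝ≥0 → X →L[ℝ] X) : Prop :=
  ∃ r : ℝ, 0 < r ∧ ∃ C : ℝ, 1 ≤ C ∧ ∀ (t : ℝ≥0) (x : X),
    N (S t x) ≤ C * Real.exp (-r * t) * N x

end Semigroups

/-! ### Sobolev spaces on the interval `(0, ℓ)` -/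

/-- Smooth functions with compact support contained in the open set `U ⊆ ℝ`. -/
def IsTest (U : Set ℝ) (f : ℝ → ℝ) : Prop :=
  ContDiff ℝ ∞ f ∧ HasCompactSupport f ∧ tsupport f ⊆ U

theorem IsTest.continuous {U : Set ℝ} {f : ℝ → ℝ} (h : IsTest U f) : Continuous f :=
  h.1.continuous

theorem IsTest.continuous_deriv {U : Set ℝ} {f : ℝ → ℝ} (h : IsTest U f) :
    Continuous (deriv f) :=
  h.1.continuous_deriv (by simp)

/-- Lebesgue measure on `(0, ℓ)`. -/
abbrev beam (ℓ : ℝ) : Measure ℝ := volume.restrict (Ioo 0 ℓ)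

/-- `L²(0, ℓ)`. -/
abbrev L2 (ℓ : ℝ) : Type := Lp ℝ 2 (beam ℓ)

theorem IsTest.memLp {ℓ : ℝ} {U : Set ℝ} {f : ℝ → ℝ} (h : IsTest U f) : MemLp f 2 (beam ℓ) :=
  h.continuous.memLp_of_hasCompactSupport h.2.1

theorem IsTest.memLp_deriv {ℓ : ℝ} {U : Set ℝ} {f : ℝ → ℝ} (h : IsTest U f) :
    MemLp (deriv f) 2 (beam ℓ) :=
  h.continuous_deriv.memLp_of_hasCompactSupport h.2.1.deriv

/-- `g` is the weak derivative of `f` on `(0, ℓ)`. -/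
def HasWeakDeriv {ℓ : ℝ} (f g : L2 ℓ) : Prop :=
  ∀ φ : ℝ → ℝ, IsTest (Ioo 0 ℓ) φ →
    ∫ x in Ioo 0 ℓ, f x * deriv φ x = -∫ x in Ioo 0 ℓ, g x * φ x

/-- Pairs of `L²` functions; a Sobolev function `u` is stored as the pair `(u, uₓ)`, so that the
norm of the pair is the usual `H¹` norm. -/
abbrev L2Pair (ℓ : ℝ) : Type := WithLp 2 (L2 ℓ × L2 ℓ)

/-- The function `u` underlying the pair `(u, uₓ)`. -/
def fn {ℓ : ℝ} (u : L2Pair ℓ) : L2 ℓ := u.fst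

/-- The weak derivative `uₓ` stored in the pair `(u, uₓ)`. -/
def dx {ℓ : ℝ} (u : L2Pair ℓ) : L2 ℓ := u.snd

theorem integrable_mul {ℓ : ℝ} (f : L2 ℓ) {φ : ℝ → ℝ} (h : MemLp φ 2 (beam ℓ)) :
    Integrable (fun x => f x * φ x) (beam ℓ) :=
  (Lp.memLp f).integrable_mul h

theorem integral_add_mul {ℓ : ℝ} (f g : L2 ℓ) {φ : ℝ → ℝ} (h : MemLp φ 2 (beam ℓ)) :
    ∫ x in Ioo 0 ℓ, (f + g : L2 ℓ) x * φ x =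
      (∫ x in Ioo 0 ℓ, f x * φ x) + ∫ x in Ioo 0 ℓ, g x * φ x := by
  rw [← integral_add (integrable_mul f h) (integrable_mul g h)]
  apply integral_congr_ae
  filter_upwards [Lp.coeFn_add f g] with x hx
  rw [hx, Pi.add_apply, add_mul]

theorem integral_smul_mul {ℓ : ℝ} (c : ℝ) (f : L2 ℓ) (φ : ℝ → ℝ) :
    ∫ x in Ioo 0 ℓ, (c • f : L2 ℓ) x * φ x = c * ∫ x in Ioo 0 ℓ, f x * φ x := by
  rw [← integral_const_mul]
  apply integral_congr_ae
  filter_upwards [Lp.coeFn_smul c f] with x hx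
  rw [hx, Pi.smul_apply, smul_eq_mul, mul_assoc]

theorem integral_zero_mul {ℓ : ℝ} (φ : ℝ → ℝ) :
    ∫ x in Ioo 0 ℓ, (0 : L2 ℓ) x * φ x = 0 := by
  simpa using integral_smul_mul (0 : ℝ) (0 : L2 ℓ) φ

/-- The zero-mean space `L²_*(0, ℓ)`. -/
def L2star (ℓ : ℝ) : Submodule ℝ (L2 ℓ) where
  carrier := {f | ∫ x in Ioo 0 ℓ, f x = 0}
  zero_mem' := by
    have := integral_zero_mul (ℓ := ℓ) (fun _ => 1)
    simpa using this
  add_mem' := by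
    intro f g hf hg
    have := integral_add_mul f g (φ := fun _ => 1) (memLp_const 1)
    simp only [mul_one, mem_ofPred_eq] at *
    rw [this, hf, hg, add_zero]
  smul_mem' := by
    intro c f hf
    have := integral_smul_mul c f (fun _ => 1)
    simp only [mul_one, mem_ofPred_eq] at *
    rw [this, hf, mul_zero]

/-- The Sobolev space `H¹(0, ℓ)`. -/
def H1 (ℓ : ℝ) : Submodule ℝ (L2Pair ℓ) where
  carrier := {u | HasWeakDeriv (fn u) (dx u)}
  zero_mem' := by
    intro φ _
    change ∫ x in Ioo 0 ℓ, (0 : L2 ℓ) x * deriv φ x = -∫ x in Ioo 0 ℓ, (0 : L2 ℓ) x * φ x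
    rw [integral_zero_mul, integral_zero_mul, neg_zero]
  add_mem' := by
    intro u v hu hv φ hφ
    change ∫ x in Ioo 0 ℓ, (fn u + fn v : L2 ℓ) x * deriv φ x =
      -∫ x in Ioo 0 ℓ, (dx u + dx v : L2 ℓ) x * φ x
    rw [integral_add_mul _ _ hφ.memLp_deriv, integral_add_mul _ _ hφ.memLp, hu φ hφ, hv φ hφ]
    ring
  smul_mem' := by
    intro c u hu φ hφ
    change ∫ x in Ioo 0 ℓ, (c • fn u : L2 ℓ) x * deriv φ x =
      -∫ x in Ioo 0 ℓ, (c • dx u : L2 ℓ) x * φ x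
    rw [integral_smul_mul, integral_smul_mul, hu φ hφ]
    ring

/-- The space `H¹_*(0, ℓ) = H¹(0, ℓ) ∩ L²_*(0, ℓ)`. -/
def H1star (ℓ : ℝ) : Submodule ℝ (L2Pair ℓ) where
  carrier := {u | u ∈ H1 ℓ ∧ fn u ∈ L2star ℓ}
  zero_mem' := ⟨(H1 ℓ).zero_mem, (L2star ℓ).zero_mem⟩
  add_mem' := fun hu hv => ⟨(H1 ℓ).add_mem hu.1 hv.1, (L2star ℓ).add_mem hu.2 hv.2⟩
  smul_mem' := fun c _ hu => ⟨(H1 ℓ).smul_mem c hu.1, (L2star ℓ).smul_mem c hu.2⟩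

/-- The pair `(φ, φ')` of a test function on `(0, ℓ)`. -/
def testPair {ℓ : ℝ} (φ : {φ : ℝ → ℝ // IsTest (Ioo 0 ℓ) φ}) : L2Pair ℓ :=
  WithLp.toLp 2 (φ.2.memLp.toLp φ.1, φ.2.memLp_deriv.toLp (deriv φ.1))

/-- The space `H¹₀(0, ℓ)`: the closure of the test functions in the `H¹` norm. (By the Poincaré
inequality, this norm is equivalent on `H¹₀` to the gradient norm `‖dx u‖`.) -/
def H01 (ℓ : ℝ) : Submodule ℝ (L2Pair ℓ) :=
  (Submodule.span ℝ (range (testPair (ℓ := ℓ)))).topologicalClosure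

instance (ℓ : ℝ) : CompleteSpace (H01 ℓ) :=
  Submodule.topologicalClosure.completeSpace _

/-! ### The physical constants and the memory space -/

/-- The length of the beam and the physical constants, all strictly positive. -/
structure Params where
  (ℓ ρ₁ ρ₂ ρ₃ κ b δ β τ : ℝ)
  ℓ_pos : 0 < ℓ
  ρ₁_pos : 0 < ρ₁
  ρ₂_pos : 0 < ρ₂
  ρ₃_pos : 0 < ρ₃
  κ_pos : 0 < κ
  b_pos : 0 < b
  δ_pos : 0 < δ
  β_pos : 0 < β
  τ_pos : 0 < τ

/-- The exponential kernel `μ = -g'`, where `g(s) = (β/τ) exp (-sβ/τ)`. -/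
def kernel (p : Params) (s : ℝ) : ℝ := p.β ^ 2 / p.τ ^ 2 * Real.exp (-(s * p.β / p.τ))

/-- The measure `μ(s) ds` on `(0, ∞)`. -/
def memMeasure (p : Params) : Measure ℝ :=
  (volume.restrict (Ioi 0)).withDensity (fun s => ENNReal.ofReal (kernel p s))

/-- The memory space `𝓜 = L²(ℝ⁺, μ(s) ds; H¹₀)`. -/
abbrev Mem (p : Params) : Type := Lp (H01 p.ℓ) 2 (memMeasure p)

/-- The square of the norm of `𝓜`, that is `∫₀^∞ μ(s) ‖ηₓ(s)‖² ds`. -/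
def memNormSq (p : Params) (η : Mem p) : ℝ := ∫ s, ‖dx (η s : L2Pair p.ℓ)‖ ^ 2 ∂(memMeasure p)

/-- `ξ` is the weak derivative of `η` with respect to the internal variable `s ∈ (0, ∞)`. -/
def HasWeakDerivMem (p : Params) (η ξ : Mem p) : Prop :=
  ∀ χ : ℝ → ℝ, IsTest (Ioi 0) χ →
    ∫ s in Ioi (0 : ℝ), deriv χ s • η s = -∫ s in Ioi (0 : ℝ), χ s • ξ s

/-- `η ∈ D(T)` and `T η = ζ`: the weak derivative of `η` is `-ζ ∈ 𝓜`, and `‖ηₓ(s)‖ → 0` as `s → 0`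
for the continuous representative of `η`. -/
def IsT (p : Params) (η ζ : Mem p) : Prop :=
  HasWeakDerivMem p η (-ζ) ∧
    ∃ η' : ℝ → H01 p.ℓ, ContinuousOn η' (Ioi 0) ∧ η =ᵐ[memMeasure p] η' ∧
      Tendsto (fun s => ‖dx (η' s : L2Pair p.ℓ)‖) (𝓝[>] 0) (𝓝 0)

/-! ### The phase spaces

The product topologies below are those of the norms `gpNorm` and `catNorm`, by the Poincaré
inequalities. -/

/-- The common phase space of `u = (φ, φ̃, ψ, ψ̃, θ)`. -/
abbrev Phase5 (p : Params) : Type :=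
  H01 p.ℓ × L2 p.ℓ × H1star p.ℓ × L2star p.ℓ × L2 p.ℓ

/-- The phase space of the Timoshenko-Gurtin-Pipkin system: states `(u, η)`. -/
abbrev GPSpace (p : Params) : Type := Phase5 p × Mem p

/-- The phase space of the Timoshenko-Cattaneo system: states `(u, q)`. -/
abbrev CatSpace (p : Params) : Type := Phase5 p × L2 p.ℓ

namespace Phase5

variable {p : Params}

/-- The component `φ`. -/
def phi (u : Phase5 p) : L2Pair p.ℓ := u.1

/-- The component `φ̃`. -/
def phit (u : Phase5 p) : L2 p.ℓ := u.2.1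

/-- The component `ψ`. -/
def psi (u : Phase5 p) : L2Pair p.ℓ := u.2.2.1

/-- The component `ψ̃`. -/
def psit (u : Phase5 p) : L2 p.ℓ := u.2.2.2.1

/-- The component `θ`. -/
def theta (u : Phase5 p) : L2 p.ℓ := u.2.2.2.2

/-- `κ‖φₓ+ψ‖² + ρ₁‖φ̃‖² + b‖ψₓ‖² + ρ₂‖ψ̃‖² + ρ₃‖θ‖²`. -/
def energy (u : Phase5 p) : ℝ :=
  p.κ * ‖dx (phi u) + fn (psi u)‖ ^ 2 + p.ρ₁ * ‖phit u‖ ^ 2 + p.b * ‖dx (psi u)‖ ^ 2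
    + p.ρ₂ * ‖psit u‖ ^ 2 + p.ρ₃ * ‖theta u‖ ^ 2

end Phase5

/-- The norm of the phase space of the Timoshenko-Gurtin-Pipkin system. -/
def gpNorm (p : Params) (z : GPSpace p) : ℝ :=
  Real.sqrt (Phase5.energy z.1 + 1 / p.β * memNormSq p z.2)

/-- The norm of the phase space of the Timoshenko-Cattaneo system. -/
def catNorm (p : Params) (z : CatSpace p) : ℝ :=
  Real.sqrt (Phase5.energy z.1 + p.τ * ‖z.2‖ ^ 2)

/-! ### The two generators -/

open Phase5 in
/-- The first four rows of both evolution systems, `u ↦ v`, together with the conditions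
`φ ∈ H²`, `φ̃ ∈ H¹₀`, `ψₓ ∈ H¹₀`, `ψ̃ ∈ H¹_*` on the state and with `θ` an element of `H¹₀`.
Here `φx` and `ψx` are the derivatives of `φ` and `ψ` as elements of `H¹` and `H¹₀`. -/
def MechRows (p : Params) (u v : Phase5 p) (θ : H01 p.ℓ) : Prop :=
  fn (θ : L2Pair p.ℓ) = theta u ∧
  fn (phi v) = phit u ∧
  (∃ φx : H1 p.ℓ, fn (φx : L2Pair p.ℓ) = dx (phi u) ∧
    phit v = (p.κ / p.ρ₁) • (dx (φx : L2Pair p.ℓ) + dx (psi u))) ∧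
  fn (psi v) = psit u ∧
  (∃ ψx : H01 p.ℓ, fn (ψx : L2Pair p.ℓ) = dx (psi u) ∧
    psit v = (p.b / p.ρ₂) • dx (ψx : L2Pair p.ℓ)
      - (p.κ / p.ρ₂) • (dx (phi u) + fn (psi u)) - (p.δ / p.ρ₂) • dx (θ : L2Pair p.ℓ))

open Phase5 in
/-- The graph of the operator `𝔸` of the Timoshenko-Gurtin-Pipkin system with kernel `μ`:
`z = (u, η) ∈ D(𝔸)` and `𝔸 z = w`. The element `dx (psi w.1)` is `ψ̃ₓ`, since `psi w.1` is `ψ̃` as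
an element of `H¹_*`; `ζx` is the derivative of `∫ μ(s) η(s) ds` as an element of `H¹`. -/
def gpGraph (p : Params) (z w : GPSpace p) : Prop :=
  ∃ θ : H01 p.ℓ, MechRows p z.1 w.1 θ ∧
    (∃ ζx : H1 p.ℓ,
      fn (ζx : L2Pair p.ℓ) = dx ((∫ s, z.2 s ∂(memMeasure p) : H01 p.ℓ) : L2Pair p.ℓ) ∧
      theta w.1 = (1 / (p.β * p.ρ₃)) • dx (ζx : L2Pair p.ℓ) - (p.δ / p.ρ₃) • dx (psi w.1)) ∧
    ∃ ζ : Mem p, IsT p z.2 ζ ∧ w.2 =ᵐ[memMeasure p] fun s => ζ s + θ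

open Phase5 in
/-- The graph of the operator of the Timoshenko-Cattaneo system: `z = (u, q)` is in the domain,
which requires `q ∈ H¹`, and is mapped to `w`. As above, `dx (psi w.1)` is `ψ̃ₓ`. -/
def catGraph (p : Params) (z w : CatSpace p) : Prop :=
  ∃ θ : H01 p.ℓ, MechRows p z.1 w.1 θ ∧
    ∃ q : H1 p.ℓ, fn (q : L2Pair p.ℓ) = z.2 ∧
      theta w.1 = -(1 / p.ρ₃) • dx (q : L2Pair p.ℓ) - (p.δ / p.ρ₃) • dx (psi w.1) ∧
      w.2 = -(p.β / p.τ) • z.2 - (1 / p.τ) • dx (θ : L2Pair p.ℓ)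

end Timoshenko

end

noncomputable section

namespace Timoshenko

/-! ### Strongly continuous semigroups -/

section SemigroupTheory

variable {X Y : Type*} [NormedAddCommGroup X] [NormedSpace ℝ X]
  [NormedAddCommGroup Y] [NormedSpace ℝ Y]
  {S : ℝ≥0 → X →L[ℝ] X} {R : ℝ≥0 → Y →L[ℝ] Y} {G : X → X → Prop} {K : Y → Y → Prop}

/-! For an exponential kernel, `μ' = -(β/τ) μ`, so one average of the memory obeys a closed
equation. Put `q = -(1/β) ∫ μ(s) ηₓ(s) ds`. Integrating by parts in `s` (`IsT.dx_integral_eq`) and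
using that `μ` has mass `β/τ`, the equation `η_t = Tη + θ` becomes Cattaneo's law `τ q_t + β q + θₓ
= 0`. Hence the bounded map `flux : (u, η) ↦ (u, q)` carries one generator into the other
(`gpGraph.catGraph_flux`), and therefore one semigroup into the other (`IsGenerator.intertwine`,
`flux_semigroup`). Cauchy–Schwarz gives `τ‖q‖² ≤ (1/β)‖η‖²`, so `flux` does not increase the norms
(`catNorm_flux_le`). The assumed decay thus reaches all components of the Gurtin–Pipkin solution
except `η` (`energy_le_of_stable`).

The memory is recovered from the energy. Let `F` be the squared norm along an orbit starting in the
domain and `e` its part without the memory. The conservative terms cancel by parts, and `T`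
dissipates at rate `β/τ`, again because of `μ' = -(β/τ) μ` (`IsT.inner_le`, `gpGraph.gpInner_le`).
This gives `F' ≤ -(β/τ)(F - e)` with `e` exponentially small, and Grönwall's argument
(`le_of_deriv_le_of_source_le`) yields decay of `F`. Density of the domain gives the estimate for
all data.

The calculus in `s` is done on weak derivatives: the fundamental theorem
`HasWeakDerivIoi.integral_eq_sub`, the chain rule `norm_sq_sub_norm_sq_eq_integral`, and their
weighted forms on the half line. -/

theorem tendsto_toNNReal_nhdsGT_zero : Tendsto Real.toNNReal (𝓝[>] 0) (𝓝[>] 0) := by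
  refine tendsto_nhdsWithin_iff.2 ⟨?_, ?_⟩
  · have := (continuous_real_toNNReal.tendsto 0).mono_left (nhdsWithin_le_nhds (s := Ioi (0 : ℝ)))
    simpa using this
  · filter_upwards [self_mem_nhdsWithin] with x hx
    simpa using hx

theorem IsGenerator.map (hS : IsC0Semigroup S) (hG : IsGenerator S G) {z w : X} (h : G z w)
    (t : ℝ≥0) : G (S t z) (S t w) := by
  rw [hG] at h ⊢
  refine (((S t).continuous.tendsto w).comp h).congr fun r => ?_
  have : S r (S t z) = S t (S r z) := by
    rw [← ContinuousLinearMap.comp_apply, ← hS.add, add_comm, hS.add,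
      ContinuousLinearMap.comp_apply]
  simp [this]

theorem IsGenerator.tendsto_real (hG : IsGenerator S G) {z w : X} (h : G z w) :
    Tendsto (fun h : ℝ => h⁻¹ • (S h.toNNReal z - z)) (𝓝[>] 0) (𝓝 w) := by
  refine (((hG z w).1 h).comp tendsto_toNNReal_nhdsGT_zero).congr' ?_
  filter_upwards [self_mem_nhdsWithin] with x hx
  simp [Real.coe_toNNReal x (le_of_lt hx)]

theorem tendsto_sub_nhdsGT (t : ℝ) : Tendsto (fun s => s - t) (𝓝[>] t) (𝓝[>] 0) := by
  refine tendsto_nhdsWithin_iff.2 ⟨?_, ?_⟩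
  · have : Continuous fun s : ℝ => s - t := by fun_prop
    simpa using (this.tendsto t).mono_left nhdsWithin_le_nhds
  · filter_upwards [self_mem_nhdsWithin] with x hx
    simpa using hx

/-- The semigroup law moves the difference quotient at time `t` back to time zero, at the state `S t
z`. Right derivatives suffice below, both for constancy and for comparison, so the left ones are not
needed. -/
theorem IsGenerator.hasDerivWithinAt (hS : IsC0Semigroup S) (hG : IsGenerator S G) {z w : X}
    (h : G z w) {t : ℝ} (ht : 0 ≤ t) :
    HasDerivWithinAt (fun s : ℝ => S s.toNNReal z) (S t.toNNReal w) (Ici t) t := by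
  rw [← hasDerivWithinAt_Ioi_iff_Ici, hasDerivWithinAt_iff_tendsto_slope' (by simp)]
  refine ((hG.tendsto_real (hG.map hS h t.toNNReal)).comp (tendsto_sub_nhdsGT t)).congr' ?_
  filter_upwards [self_mem_nhdsWithin] with s hs
  have hs' : t < s := hs
  have : s.toNNReal = (s - t).toNNReal + t.toNNReal := by
    rw [← Real.toNNReal_add (by linarith) ht, sub_add_cancel]
  simp [slope, this, hS.add]

variable [CompleteSpace X] [CompleteSpace Y]

/-- Otherwise there are `t n → 0` with `‖S (t n)‖ > n`. The orbits `S (t n) x` converge, hence are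
bounded for each `x`, which contradicts uniform boundedness. -/
theorem IsC0Semigroup.exists_bound_near_zero (hS : IsC0Semigroup S) :
    ∃ ε : ℝ≥0, 0 < ε ∧ ∃ M : ℝ, ∀ t ≤ ε, ‖S t‖ ≤ M := by
  by_contra! h
  have hpos : ∀ n : ℕ, (0 : ℝ≥0) < 1 / ((n : ℝ≥0) + 1) := fun n => by positivity
  choose t ht hM using fun n : ℕ => h (1 / ((n : ℝ≥0) + 1)) (hpos n) n
  have ht0 : Tendsto t atTop (𝓝 0) :=
    tendsto_of_tendsto_of_tendsto_of_le_of_le tendsto_const_nhds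
      (NNReal.tendsto_coe.1 (by simpa using tendsto_one_div_add_atTop_nhds_zero_nat (𝕜 := ℝ)))
      (fun n => zero_le) ht
  obtain ⟨C, hC⟩ := banach_steinhaus (g := fun n => S (t n)) fun x => by
    obtain ⟨C, hC⟩ := ((hS.tendsto_zero x).comp ht0).norm.bddAbove_range
    exact ⟨C, fun n => hC ⟨n, rfl⟩⟩
  obtain ⟨n, hn⟩ := exists_nat_gt C
  exact (((hM n).trans_le (hC n)).trans hn).false

theorem IsC0Semigroup.exists_bound (hS : IsC0Semigroup S) (T : ℝ≥0) :
    ∃ M : ℝ, ∀ t ≤ T, ‖S t‖ ≤ M := by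
  obtain ⟨ε, hε, M, hM⟩ := hS.exists_bound_near_zero
  have hM0 : 0 ≤ M := (norm_nonneg _).trans (hM 0 zero_le)
  have key : ∀ n : ℕ, ∃ K : ℝ, ∀ t ≤ n * ε, ‖S t‖ ≤ K := by
    intro n
    induction n with
    | zero => exact ⟨M, fun t ht => hM t (by simp at ht; simp [ht])⟩
    | succ n ih =>
      obtain ⟨K, hK⟩ := ih
      have hK0 : 0 ≤ K := (norm_nonneg _).trans (hK 0 zero_le)
      refine ⟨max K (M * K), fun t ht => ?_⟩
      rcases le_total t (n * ε) with h | h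
      · exact (hK t h).trans (le_max_left _ _)
      · have h1 : t = (t - n * ε) + n * ε := (tsub_add_cancel_of_le h).symm
        have h2 : t - n * ε ≤ ε := by
          rw [tsub_le_iff_right]
          push_cast at ht
          linarith
        rw [h1, hS.add]
        exact ((ContinuousLinearMap.opNorm_comp_le _ _).trans
          (mul_le_mul (hM _ h2) (hK _ le_rfl) (norm_nonneg _) hM0)).trans (le_max_right _ _)
  obtain ⟨n, hn⟩ := exists_nat_gt (T / ε)
  obtain ⟨K, hK⟩ := key n
  refine ⟨K, fun t ht => hK t (ht.trans ?_)⟩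
  rw [div_lt_iff₀ hε] at hn
  exact hn.le

/-- Whichever of `t`, `t₀` is smaller can be factored out, leaving `S d x - x` with `d = |t - t₀|`.
The local bound controls the factor; it is indispensable on the left of `t₀`, where the factor
varies with `t`. -/
theorem IsC0Semigroup.continuous_orbit (hS : IsC0Semigroup S) (x : X) :
    Continuous fun t => S t x := by
  rw [continuous_iff_continuousAt]
  intro t₀
  obtain ⟨M, hM⟩ := hS.exists_bound (t₀ + 1)
  have h0 : Tendsto (fun t => M * ‖S (nndist t t₀) x - x‖) (𝓝 t₀) (𝓝 0) := by
    have h1 : Tendsto (fun t : ℝ≥0 => nndist t t₀) (𝓝 t₀) (𝓝 0) := by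
      have : Continuous fun t : ℝ≥0 => nndist t t₀ := by fun_prop
      simpa using this.tendsto t₀
    simpa using ((((hS.tendsto_zero x).comp h1).sub_const x).norm.const_mul M)
  rw [ContinuousAt, tendsto_iff_norm_sub_tendsto_zero]
  refine squeeze_zero' (Eventually.of_forall fun _ => norm_nonneg _) ?_ h0
  filter_upwards [eventually_le_nhds (show t₀ < t₀ + 1 by simp)] with t ht
  have aux : ∀ s d : ℝ≥0, s ≤ t₀ + 1 → ‖S (s + d) x - S s x‖ ≤ M * ‖S d x - x‖ := by
    intro s d hs
    rw [hS.add, ContinuousLinearMap.comp_apply, ← map_sub]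
    exact (S s).le_of_opNorm_le (hM s hs) _
  rcases le_total t₀ t with h | h
  · have hd : t = t₀ + nndist t t₀ := by
      apply NNReal.eq
      have : (t₀ : ℝ) ≤ t := h
      rw [NNReal.coe_add, coe_nndist, NNReal.dist_eq, abs_of_nonneg (by linarith)]
      ring
    have := aux t₀ (nndist t t₀) (by simp)
    rwa [← hd] at this
  · have hd : t₀ = t + nndist t t₀ := by
      apply NNReal.eq
      have : (t : ℝ) ≤ t₀ := h
      rw [NNReal.coe_add, coe_nndist, NNReal.dist_eq, abs_of_nonpos (by linarith)]
      ring
    have := aux t (nndist t t₀) ht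
    rwa [← hd, norm_sub_rev] at this

theorem IsC0Semigroup.tendsto_apply (hS : IsC0Semigroup S) {ι : Type*} {l : Filter ι}
    {r : ι → ℝ≥0} {r₀ : ℝ≥0} {x : ι → X} {x₀ : X} (hr : Tendsto r l (𝓝 r₀))
    (hx : Tendsto x l (𝓝 x₀)) : Tendsto (fun i => S (r i) (x i)) l (𝓝 (S r₀ x₀)) := by
  obtain ⟨M, hM⟩ := hS.exists_bound (r₀ + 1)
  have h1 : Tendsto (fun i => S (r i) (x i - x₀)) l (𝓝 0) := by
    have h0 : Tendsto (fun i => M * ‖x i - x₀‖) l (𝓝 0) := by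
      simpa using (hx.sub_const x₀).norm.const_mul M
    refine squeeze_zero_norm' ?_ h0
    filter_upwards [hr.eventually (eventually_le_nhds (show r₀ < r₀ + 1 by simp))] with i hi
    exact (S (r i)).le_of_opNorm_le (hM _ hi) _
  have h2 := h1.add (((hS.continuous_orbit x₀).tendsto r₀).comp hr)
  simpa using h2

/-- The averages `h⁻¹ ∫₀ʰ S(s)x ds` tend to `x`, and they lie in the domain: shifting the interval
of integration shows that the generator sends `∫₀ʰ S(s)x ds` to `S(h)x - x`. -/
theorem IsGenerator.dense_domain (hS : IsC0Semigroup S) (hG : IsGenerator S G) :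
    Dense {z | ∃ w, G z w} := by
  intro x
  set f : ℝ → X := fun s => S s.toNNReal x with hf
  have hfc : Continuous f := (hS.continuous_orbit x).comp continuous_real_toNNReal
  have hfi : ∀ a b, IntervalIntegrable f volume a b := fun a b => hfc.intervalIntegrable a b
  have hdiff : ∀ c, Tendsto (fun r : ℝ => r⁻¹ • ∫ s in c..(c + r), f s) (𝓝[>] 0) (𝓝 (f c)) := by
    intro c
    have := (hfc.integral_hasStrictDerivAt c c).hasDerivAt.hasDerivWithinAt (s := Ioi c)
    rw [hasDerivWithinAt_iff_tendsto_slope' (by simp)] at this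
    have h2 : Tendsto (fun r : ℝ => c + r) (𝓝[>] 0) (𝓝[>] c) := by
      refine tendsto_nhdsWithin_iff.2 ⟨?_, ?_⟩
      · have : Continuous fun s : ℝ => c + s := by fun_prop
        simpa using (this.tendsto 0).mono_left nhdsWithin_le_nhds
      · filter_upwards [self_mem_nhdsWithin] with x hx
        simpa using hx
    refine (this.comp h2).congr fun r => ?_
    simp [slope]
  have hmem : ∀ h : ℝ, 0 < h → (∫ s in (0 : ℝ)..h, f s) ∈ {z | ∃ w, G z w} := by
    intro h hh
    refine ⟨f h - f 0, (hG _ _).2 ?_⟩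
    have hconv : Tendsto (fun r : ℝ≥0 => (r : ℝ)) (𝓝[>] 0) (𝓝[>] 0) := by
      refine tendsto_nhdsWithin_iff.2 ⟨?_, ?_⟩
      · simpa using (NNReal.continuous_coe.tendsto 0).mono_left
          (nhdsWithin_le_nhds (s := Ioi (0 : ℝ≥0)))
      · filter_upwards [self_mem_nhdsWithin] with x hx
        simpa using hx
    have h3 := ((hdiff h).sub (hdiff 0)).comp hconv
    refine h3.congr fun r => ?_
    have e1 : S r (∫ s in (0 : ℝ)..h, f s) = ∫ s in (r : ℝ)..(h + r), f s := by
      rw [← ContinuousLinearMap.intervalIntegral_comp_comm _ (hfi _ _)]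
      have : ∫ s in (0 : ℝ)..h, S r (f s) = ∫ s in (0 : ℝ)..h, f (s + r) := by
        refine intervalIntegral.integral_congr fun s hs => ?_
        rw [uIcc_of_le hh.le] at hs
        change S r (S s.toNNReal x) = S (s + r).toNNReal x
        rw [Real.toNNReal_add hs.1 r.coe_nonneg, Real.toNNReal_coe, add_comm, hS.add,
          ContinuousLinearMap.comp_apply]
      rw [this, intervalIntegral.integral_comp_add_right, zero_add]
    have e2 : (∫ s in (r : ℝ)..(h + r), f s) =
        (∫ s in (0 : ℝ)..h, f s) + (∫ s in h..(h + r), f s) - ∫ s in (0 : ℝ)..r, f s := by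
      rw [intervalIntegral.integral_add_adjacent_intervals (hfi _ _) (hfi _ _),
        intervalIntegral.integral_interval_sub_left (hfi _ _) (hfi _ _)]
    simp only [Function.comp, e1, e2, zero_add]
    rw [← smul_sub, add_sub_assoc, add_sub_cancel_left]
  have hlim := hdiff 0
  rw [show f 0 = x by simp [hf, hS.zero]] at hlim
  refine mem_closure_of_tendsto hlim ?_
  filter_upwards [self_mem_nhdsWithin] with h hh
  obtain ⟨w, hw⟩ := hmem h hh
  refine ⟨h⁻¹ • w, ?_⟩
  rw [zero_add]
  rw [hG] at hw ⊢
  refine (hw.const_smul h⁻¹).congr fun r => ?_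
  rw [map_smul, ← smul_sub, smul_comm]

/-- A bounded operator which intertwines two generators intertwines the semigroups. -/
theorem IsGenerator.intertwine (hS : IsC0Semigroup S) (hG : IsGenerator S G)
    (hR : IsC0Semigroup R) (hK : IsGenerator R K) (L : X →L[ℝ] Y)
    (hL : ∀ z w, G z w → K (L z) (L w)) (t : ℝ≥0) (z : X) : L (S t z) = R t (L z) := by
  have hcl : IsClosed {z : X | L (S t z) = R t (L z)} := isClosed_eq (by fun_prop) (by fun_prop)
  refine hcl.closure_subset_iff.2 ?_ (hG.dense_domain hS z)
  rintro z ⟨w, hzw⟩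
  -- This curve joins `R t (L z)` at `s = 0` to `L (S t z)` at `s = t`. It remains to show that it
  -- is constant.
  set v : ℝ → Y := fun s => R (t - s).toNNReal (L (S s.toNNReal z)) with hv
  have hcont : Continuous v := by
    rw [continuous_iff_continuousAt]
    intro s
    refine hR.tendsto_apply ?_ ?_
    · exact (continuous_real_toNNReal.comp (by fun_prop : Continuous fun s : ℝ => t - s)).tendsto s
    · exact (L.continuous.comp
        ((hS.continuous_orbit z).comp continuous_real_toNNReal)).tendsto s
  have hderiv : ∀ s ∈ Ico (0 : ℝ) t, HasDerivWithinAt v 0 (Ici s) s := by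
    intro s hs
    rw [← hasDerivWithinAt_Ioi_iff_Ici, hasDerivWithinAt_iff_tendsto_slope' (by simp)]
    have h1 : Tendsto (fun r : ℝ => (r - s)⁻¹ • (L (S r.toNNReal z) - L (S s.toNNReal z)))
        (𝓝[>] s) (𝓝 (L (S s.toNNReal w))) := by
      have := (hG.hasDerivWithinAt hS hzw hs.1)
      rw [← hasDerivWithinAt_Ioi_iff_Ici, hasDerivWithinAt_iff_tendsto_slope' (by simp)] at this
      refine ((L.continuous.tendsto _).comp this).congr fun r => ?_
      simp [slope]
    have h2 := (hK.tendsto_real (hL _ _ (hG.map hS hzw s.toNNReal))).comp (tendsto_sub_nhdsGT s)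
    have h3 : Tendsto (fun r : ℝ => ((t : ℝ) - r).toNNReal) (𝓝[>] s) (𝓝 ((t : ℝ) - s).toNNReal) :=
      ((continuous_real_toNNReal.comp
        (by fun_prop : Continuous fun s : ℝ => t - s)).tendsto s).mono_left nhdsWithin_le_nhds
    have h4 := hR.tendsto_apply h3 (h1.sub h2)
    -- With `R(t - r)` factored out, the quotient of `v` is the quotient of `L S z` minus that of
    -- `R` at `L (S s z)`. Both tend to `L (S s w)`, the second by the intertwining of the
    -- generators.
    rw [sub_self, map_zero] at h4
    refine h4.congr' ?_
    filter_upwards [self_mem_nhdsWithin, nhdsWithin_le_nhds (Iio_mem_nhds hs.2)] with r hr hrt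
    have hr' : s < r := hr
    have hrt' : r < t := hrt
    have e : ((t : ℝ) - s).toNNReal = ((t : ℝ) - r).toNNReal + (r - s).toNNReal := by
      rw [← Real.toNNReal_add (by linarith) (by linarith)]
      congr 1
      ring
    simp only [Function.comp, slope, hv, e, hR.add, ContinuousLinearMap.comp_apply,
      vsub_eq_sub]
    rw [← smul_sub, map_smul, sub_sub_sub_cancel_right, map_sub]
  have := constant_of_has_deriv_right_zero hcont.continuousOn hderiv t ⟨t.2, le_rfl⟩
  simpa [hv, hR.zero, hS.zero] using this
end SemigroupTheory

/-! ### Weak derivatives on the half line -/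

section HalfLine

open Real (smoothTransition)

variable {E : Type*} [NormedAddCommGroup E] [NormedSpace ℝ E]

/-- The integral of a function against a test function on the half line converges. -/
theorem IsTest.integrableOn_smul {χ : ℝ → ℝ} {f : ℝ → E} (hχ : Continuous χ)
    (hc : HasCompactSupport χ) (hsupp : tsupport χ ⊆ Ioi 0) (hf : LocallyIntegrableOn f (Ioi 0)) :
    IntegrableOn (fun s => χ s • f s) (Ioi 0) := by
  have h1 : IntegrableOn (fun s => χ s • f s) (tsupport χ) :=
    (hf.integrableOn_compact_subset hsupp hc).continuousOn_smul hχ.continuousOn hc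
  refine h1.of_forall_sdiff_eq_zero measurableSet_Ioi fun x hx => ?_
  rw [image_eq_zero_of_notMem_tsupport hx.2, zero_smul]

/-- `g` is the weak derivative of `y` on `(0, ∞)`. -/
def HasWeakDerivIoi (y g : ℝ → E) : Prop :=
  ∀ χ : ℝ → ℝ, IsTest (Ioi 0) χ →
    ∫ s in Ioi (0 : ℝ), deriv χ s • y s = -∫ s in Ioi (0 : ℝ), χ s • g s

/-- The product of a test function with a smooth `m` is again a test function. This brings the
exponential weight under the weak derivative. -/
theorem HasWeakDerivIoi.smul {y g : ℝ → E} (h : HasWeakDerivIoi y g)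
    (hy : LocallyIntegrableOn y (Ioi 0)) (hg : LocallyIntegrableOn g (Ioi 0))
    {m : ℝ → ℝ} (hm : ContDiff ℝ ∞ m) :
    HasWeakDerivIoi (fun s => m s • y s) (fun s => m s • g s + deriv m s • y s) := by
  intro χ hχ
  have hm' : Continuous (deriv m) := hm.continuous_deriv (by simp)
  have hts : tsupport (fun s => χ s * m s) ⊆ tsupport χ := tsupport_mul_subset_left
  have hχm : IsTest (Ioi 0) (fun s => χ s * m s) :=
    ⟨hχ.1.mul hm, hχ.2.1.mul_right, hts.trans hχ.2.2⟩
  have hd : ∀ s, deriv (fun s => χ s * m s) s = deriv χ s * m s + χ s * deriv m s := fun s =>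
    deriv_fun_mul (hχ.1.differentiable (by simp) s) (hm.differentiable (by simp) s)
  have i1 : IntegrableOn (fun s => deriv (fun s => χ s * m s) s • y s) (Ioi 0) :=
    IsTest.integrableOn_smul hχm.continuous_deriv hχm.2.1.deriv
      (tsupport_deriv_subset.trans hχm.2.2) hy
  have i2 : IntegrableOn (fun s => (χ s * deriv m s) • y s) (Ioi 0) :=
    IsTest.integrableOn_smul (hχ.continuous.mul hm') hχ.2.1.mul_right
      (tsupport_mul_subset_left.trans hχ.2.2) hy
  have i3 : IntegrableOn (fun s => (χ s * m s) • g s) (Ioi 0) :=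
    IsTest.integrableOn_smul hχm.continuous hχm.2.1 hχm.2.2 hg
  have e1 : ∀ s, deriv χ s • m s • y s =
      deriv (fun s => χ s * m s) s • y s - (χ s * deriv m s) • y s := fun s => by
    rw [hd, add_smul, add_sub_cancel_right, mul_smul]
  have e2 : ∀ s, χ s • (m s • g s + deriv m s • y s) =
      (χ s * m s) • g s + (χ s * deriv m s) • y s := fun s => by
    rw [smul_add, mul_smul, mul_smul]
  simp only [e1, e2]
  rw [integral_sub i1 i2, integral_add i3 i2, h _ hχm]
  abel

theorem deriv_smoothTransition_of_nonpos {u : ℝ} (hu : u ≤ 0) : deriv smoothTransition u = 0 := by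
  refine IsLocalMin.deriv_eq_zero (Eventually.of_forall fun v => ?_)
  rw [smoothTransition.zero_of_nonpos hu]
  exact smoothTransition.nonneg v

theorem deriv_smoothTransition_of_one_le {u : ℝ} (hu : 1 ≤ u) : deriv smoothTransition u = 0 := by
  refine IsLocalMax.deriv_eq_zero (Eventually.of_forall fun v => ?_)
  rw [smoothTransition.one_of_one_le hu]
  exact smoothTransition.le_one v

theorem deriv_smoothTransition_scaled (c s x : ℝ) :
    deriv (fun x => smoothTransition (c * (x - s))) x =
      c * deriv smoothTransition (c * x - c * s) := by
  have h1 : HasDerivAt (fun x => c * (x - s)) c x := by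
    simpa using ((hasDerivAt_id x).sub_const s).const_mul c
  have h2 : HasDerivAt smoothTransition (deriv smoothTransition (c * (x - s))) (c * (x - s)) :=
    ((smoothTransition.contDiff (n := 1)).differentiable (by simp) _).hasDerivAt
  have h3 : HasDerivAt (fun x => smoothTransition (c * (x - s)))
      (deriv smoothTransition (c * (x - s)) * c) x := by
    simpa [Function.comp_def] using h2.comp x h1
  rw [h3.deriv, mul_comm, mul_sub]

variable [CompleteSpace E]

/-- The derivatives of the steepened steps have integral one and live on `[s, s + 1/(n+1)]`, so they
form an approximate identity at `s`. The substitution `u = (n+1)(x - s)` fixes the profile and moves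
the limit into the argument of `y`. -/
theorem tendsto_integral_deriv_smoothTransition {y : ℝ → E} (hy : ContinuousOn y (Ioi 0)) {s : ℝ}
    (hs : 0 < s) :
    Tendsto (fun n : ℕ => ∫ x in Ioi (0 : ℝ),
      deriv (fun x => smoothTransition (((n : ℝ) + 1) * (x - s))) x • y x) atTop (𝓝 (y s)) := by
  have hσ' : Continuous (deriv smoothTransition) :=
    (smoothTransition.contDiff (n := 1)).continuous_deriv le_rfl
  have key : ∀ n : ℕ, ∫ x in Ioi (0 : ℝ),
      deriv (fun x => smoothTransition (((n : ℝ) + 1) * (x - s))) x • y x =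
      ∫ u in (0 : ℝ)..1, deriv smoothTransition u • y (s + u / ((n : ℝ) + 1)) := by
    intro n
    set c : ℝ := (n : ℝ) + 1 with hc
    have hc0 : 0 < c := by positivity
    have h1 := intervalIntegral.smul_integral_comp_mul_sub
      (fun u => deriv smoothTransition u • y (s + u / c)) (a := s) (b := s + 1 / c) c (c * s)
    rw [show c * s - c * s = 0 by ring, show c * (s + 1 / c) - c * s = 1 by field_simp; ring,
      ← intervalIntegral.integral_smul,
      intervalIntegral.integral_of_le (by have : 0 < 1 / c := by positivity
                                          linarith)] at h1
    rw [← h1]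
    have h2 : ∀ x, deriv (fun x => smoothTransition (c * (x - s))) x • y x =
        c • deriv smoothTransition (c * x - c * s) • y (s + (c * x - c * s) / c) := fun x => by
      rw [deriv_smoothTransition_scaled, mul_smul]
      congr 4
      field_simp
      ring
    simp only [h2]
    refine setIntegral_eq_of_subset_of_forall_sdiff_eq_zero measurableSet_Ioi
      (fun x hx => mem_Ioi.2 (hs.trans hx.1)) fun x hx => ?_
    have hx2 : x ≤ s ∨ s + 1 / c < x := by
      by_contra! hcon
      exact hx.2 hcon
    rcases hx2 with h | h
    · rw [deriv_smoothTransition_of_nonpos (by nlinarith), zero_smul, smul_zero]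
    · rw [deriv_smoothTransition_of_one_le, zero_smul, smul_zero]
      have : c * (s + 1 / c) < c * x := by gcongr
      rw [mul_add, mul_one_div_cancel hc0.ne'] at this
      linarith
  simp only [key]
  have hlim : ∫ u in (0 : ℝ)..1, deriv smoothTransition u • y s = y s := by
    rw [intervalIntegral.integral_smul_const, intervalIntegral.integral_deriv_eq_sub
      (fun x _ => (smoothTransition.contDiff (n := 1)).differentiable (by simp) _)
      (hσ'.intervalIntegrable _ _)]
    simp
  rw [← hlim]
  obtain ⟨M, hM⟩ := (isCompact_Icc (a := s) (b := s + 1)).exists_bound_of_continuousOn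
    (hy.mono fun x hx => hs.trans_le hx.1)
  have hmem : ∀ (n : ℕ) (u : ℝ), u ∈ Icc (0 : ℝ) 1 → s + u / ((n : ℝ) + 1) ∈ Icc s (s + 1) := by
    intro n u hu
    have h1 : 0 ≤ u / ((n : ℝ) + 1) := div_nonneg hu.1 (by positivity)
    have h2 : u / ((n : ℝ) + 1) ≤ 1 := by
      rw [div_le_one (by positivity)]
      have : (0 : ℝ) ≤ n := n.cast_nonneg
      linarith [hu.2]
    constructor <;> linarith
  refine intervalIntegral.tendsto_integral_filter_of_dominated_convergence
    (fun u => |deriv smoothTransition u| * M) ?_ ?_ ?_ ?_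
  · refine Eventually.of_forall fun n => ContinuousOn.aestronglyMeasurable ?_ measurableSet_uIoc
    refine hσ'.continuousOn.smul (hy.comp (by fun_prop) fun u hu => ?_)
    rw [uIoc_of_le zero_le_one] at hu
    exact hs.trans_le (hmem n u ⟨hu.1.le, hu.2⟩).1
  · refine Eventually.of_forall fun n => Eventually.of_forall fun u hu => ?_
    rw [uIoc_of_le zero_le_one] at hu
    rw [norm_smul, Real.norm_eq_abs]
    gcongr
    exact hM _ (hmem n u ⟨hu.1.le, hu.2⟩)
  · exact (hσ'.abs.mul continuous_const).intervalIntegrable _ _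
  · refine Eventually.of_forall fun u _ => Tendsto.const_smul ?_ _
    have h1 : Tendsto (fun n : ℕ => s + u / ((n : ℝ) + 1)) atTop (𝓝 s) := by
      have := (tendsto_one_div_add_atTop_nhds_zero_nat (𝕜 := ℝ)).const_mul u
      simpa [div_eq_mul_inv] using this.const_add s
    exact ((hy.continuousAt (Ioi_mem_nhds hs)).tendsto).comp h1

theorem tendsto_smoothTransition_scaled (x s : ℝ) :
    Tendsto (fun n : ℕ => smoothTransition (((n : ℝ) + 1) * (x - s))) atTop
      (𝓝 (if s < x then 1 else 0)) := by
  split_ifs with h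
  · refine tendsto_const_nhds.congr' ?_
    obtain ⟨N, hN⟩ := exists_nat_gt (1 / (x - s))
    filter_upwards [eventually_ge_atTop N] with n hn
    have h1 : 0 < x - s := by linarith
    rw [smoothTransition.one_of_one_le]
    rw [div_lt_iff₀ h1] at hN
    have : (N : ℝ) ≤ n := by exact_mod_cast hn
    nlinarith
  · refine tendsto_const_nhds.congr fun n => ?_
    rw [smoothTransition.zero_of_nonpos]
    have : (0 : ℝ) ≤ n := n.cast_nonneg
    nlinarith

/-- The fundamental theorem of calculus for continuous functions with a locally integrable weak
derivative. -/
theorem HasWeakDerivIoi.integral_eq_sub {y g : ℝ → E} (h : HasWeakDerivIoi y g)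
    (hy : ContinuousOn y (Ioi 0)) (hg : LocallyIntegrableOn g (Ioi 0)) {s t : ℝ} (hs : 0 < s)
    (hst : s ≤ t) : ∫ x in s..t, g x = y t - y s := by
  -- A difference of two smooth steps approximates the indicator of `(s, t]`. Its derivative
  -- concentrates at `s` with mass `1` and at `t` with mass `-1`. Since `n + 1 ≥ 1`, all supports
  -- lie in the one compact set `[s, t + 1]`, which provides the dominating function.
  set χ : ℕ → ℝ → ℝ := fun n x =>
    smoothTransition (((n : ℝ) + 1) * (x - s)) - smoothTransition (((n : ℝ) + 1) * (x - t)) with hχ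
  have hsm : ∀ (n : ℕ) (r : ℝ),
      ContDiff ℝ ∞ fun x => smoothTransition (((n : ℝ) + 1) * (x - r)) := fun n r =>
    smoothTransition.contDiff.comp (by fun_prop)
  have hzero : ∀ n x, x ∉ Icc s (t + 1) → χ n x = 0 := by
    intro n x hx
    have hn : (0 : ℝ) ≤ n := n.cast_nonneg
    have hx2 : x < s ∨ t + 1 < x := by
      by_contra! hcon
      exact hx hcon
    simp only [hχ]
    rcases hx2 with h | h
    · rw [smoothTransition.zero_of_nonpos (by nlinarith),
        smoothTransition.zero_of_nonpos (by nlinarith), sub_self]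
    · rw [smoothTransition.one_of_one_le (by nlinarith),
        smoothTransition.one_of_one_le (by nlinarith), sub_self]
  have hts : ∀ n, tsupport (χ n) ⊆ Icc s (t + 1) := fun n =>
    closure_minimal (fun x hx => by_contra fun hc => hx (hzero n x hc)) isClosed_Icc
  have htest : ∀ n, IsTest (Ioi 0) (χ n) := fun n =>
    ⟨(hsm n s).sub (hsm n t), HasCompactSupport.of_support_subset_isCompact isCompact_Icc
      ((subset_tsupport _).trans (hts n)), (hts n).trans fun x hx => hs.trans_le hx.1⟩
  have hyl : LocallyIntegrableOn y (Ioi 0) := hy.locallyIntegrableOn measurableSet_Ioi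
  have hL : Tendsto (fun n => ∫ x in Ioi (0 : ℝ), deriv (χ n) x • y x) atTop (𝓝 (y s - y t)) := by
    refine ((tendsto_integral_deriv_smoothTransition hy hs).sub
      (tendsto_integral_deriv_smoothTransition hy (hs.trans_le hst))).congr fun n => ?_
    have hint : ∀ r, 0 < r → IntegrableOn (fun x =>
        deriv (fun x => smoothTransition (((n : ℝ) + 1) * (x - r))) x • y x) (Ioi 0) := by
      intro r hr
      have hn : (0 : ℝ) ≤ n := n.cast_nonneg
      have hts' : tsupport (deriv fun x => smoothTransition (((n : ℝ) + 1) * (x - r))) ⊆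
          Icc r (r + 1) := by
        refine closure_minimal (fun x hx => by_contra fun hc => hx ?_) isClosed_Icc
        have hx2 : x < r ∨ r + 1 < x := by
          by_contra! hcon
          exact hc hcon
        rw [deriv_smoothTransition_scaled]
        rcases hx2 with h | h
        · rw [deriv_smoothTransition_of_nonpos (by nlinarith), mul_zero]
        · rw [deriv_smoothTransition_of_one_le (by nlinarith), mul_zero]
      exact IsTest.integrableOn_smul ((hsm n r).continuous_deriv (by simp))
        (HasCompactSupport.of_support_subset_isCompact isCompact_Icc
          ((subset_tsupport _).trans hts'))
        (hts'.trans fun x hx => hr.trans_le hx.1) hyl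
    rw [← integral_sub (hint s hs) (hint t (hs.trans_le hst))]
    refine integral_congr_ae (Eventually.of_forall fun x => ?_)
    have hd : deriv (χ n) x = _ := deriv_fun_sub ((hsm n s).differentiable (by simp) x)
      ((hsm n t).differentiable (by simp) x)
    simp only [hd, sub_smul]
  have hR : Tendsto (fun n => ∫ x in Ioi (0 : ℝ), χ n x • g x) atTop
      (𝓝 (∫ x in s..t, g x)) := by
    have e1 : ∫ x in s..t, g x = ∫ x in Ioi (0 : ℝ), (Ioc s t).indicator g x := by
      rw [intervalIntegral.integral_of_le hst, setIntegral_indicator measurableSet_Ioc,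
        inter_eq_right.2 fun x (hx : x ∈ Ioc s t) => mem_Ioi.2 (hs.trans hx.1)]
    rw [e1]
    have hgi : IntegrableOn g (Icc s (t + 1)) :=
      hg.integrableOn_compact_subset (fun x hx => hs.trans_le hx.1) isCompact_Icc
    refine tendsto_integral_filter_of_dominated_convergence
      ((Icc s (t + 1)).indicator fun x => ‖g x‖) ?_ ?_ ?_ ?_
    · exact Eventually.of_forall fun n => (IsTest.integrableOn_smul (htest n).continuous
        (htest n).2.1 (htest n).2.2 hg).aestronglyMeasurable
    · refine Eventually.of_forall fun n => Eventually.of_forall fun x => ?_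
      by_cases hx : x ∈ Icc s (t + 1)
      · rw [indicator_of_mem hx, norm_smul]
        refine mul_le_of_le_one_left (norm_nonneg _) ?_
        have hn : (0 : ℝ) ≤ n := n.cast_nonneg
        have h1 := smoothTransition.nonneg (((n : ℝ) + 1) * (x - s))
        have h2 := smoothTransition.nonneg (((n : ℝ) + 1) * (x - t))
        have h3 := smoothTransition.le_one (((n : ℝ) + 1) * (x - s))
        have h4 := smoothTransition.le_one (((n : ℝ) + 1) * (x - t))
        rw [Real.norm_eq_abs, abs_le]
        constructor <;> simp only [hχ] <;> linarith
      · rw [hzero n x hx, zero_smul, norm_zero, indicator_of_notMem hx]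
    · exact (IntegrableOn.integrable_indicator (f := fun x => ‖g x‖) hgi.norm
        measurableSet_Icc).integrableOn
    · refine Eventually.of_forall fun x => ?_
      have := ((tendsto_smoothTransition_scaled x s).sub
        (tendsto_smoothTransition_scaled x t)).smul_const (g x)
      convert this using 2
      by_cases hx : x ∈ Ioc s t
      · rw [indicator_of_mem hx, if_pos hx.1, if_neg hx.2.not_gt, sub_zero, one_smul]
      · rw [indicator_of_notMem hx]
        by_cases h1 : s < x
        · have h2 : t < x := by
            by_contra! h2
            exact hx ⟨h1, h2⟩
          rw [if_pos h1, if_pos h2, sub_self, zero_smul]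
        · rw [if_neg h1, if_neg (fun h2 => h1 (hst.trans_lt h2)), sub_self, zero_smul]
  have hL' := hL.congr fun n => h _ (htest n)
  have := tendsto_nhds_unique hL' hR.neg
  rw [← neg_inj, ← this, neg_sub]

end HalfLine

/-! ### Squared norms of Hilbert-valued primitives -/

section SquareNorm

variable {E : Type*} [NormedAddCommGroup E] [InnerProductSpace ℝ E] [CompleteSpace E]

/-- Used to transfer absolute continuity from the real primitive of `2M‖G‖` to the squared norm of a
vector-valued primitive. -/
theorem absolutelyContinuousOnInterval_of_dist_le {f h : ℝ → ℝ} {a b : ℝ}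
    (hh : AbsolutelyContinuousOnInterval h a b)
    (hle : ∀ x ∈ uIcc a b, ∀ y ∈ uIcc a b, dist (f x) (f y) ≤ dist (h x) (h y)) :
    AbsolutelyContinuousOnInterval f a b := by
  rw [absolutelyContinuousOnInterval_iff] at hh ⊢
  intro ε hε
  obtain ⟨δ, hδ, H⟩ := hh ε hε
  refine ⟨δ, hδ, fun I hI hlt => (Finset.sum_le_sum fun i hi => ?_).trans_lt (H I hI hlt)⟩
  exact hle _ (hI.1 i hi).1 _ (hI.1 i hi).2

/-- The chain rule for the squared norm of an indefinite integral. -/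
theorem norm_sq_sub_norm_sq_eq_integral {Y G : ℝ → E} {s t : ℝ} (hst : s ≤ t)
    (hG : IntervalIntegrable G volume s t)
    (hY : ∀ x ∈ Icc s t, ∫ r in s..x, G r = Y x - Y s) :
    ∫ x in s..t, 2 * inner ℝ (Y x) (G x) = ‖Y t‖ ^ 2 - ‖Y s‖ ^ 2 := by
  set Z : ℝ → E := fun x => Y s + ∫ r in s..x, G r with hZ
  have hYZ : ∀ x ∈ Icc s t, Y x = Z x := fun x hx => by simp [hZ, hY x hx]
  have hZc : ContinuousOn Z (Icc s t) := by
    rw [← uIcc_of_le hst]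
    exact (intervalIntegral.continuousOn_primitive_interval' hG left_mem_uIcc).const_add (Y s)
  have huIcc : uIcc s t = Icc s t := uIcc_of_le hst
  have hsub : ∀ x ∈ Icc s t, ∀ y ∈ Icc s t, IntervalIntegrable G volume x y := fun x hx y hy =>
    hG.mono_set (by rw [huIcc]; exact uIcc_subset_Icc hx hy)
  obtain ⟨M, hM⟩ := isCompact_Icc.exists_bound_of_continuousOn hZc
  have hM0 : 0 ≤ M := (norm_nonneg _).trans (hM s ⟨le_rfl, hst⟩)
  have hinner : IntervalIntegrable (fun x => 2 * inner ℝ (Z x) (G x)) volume s t := by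
    refine IntervalIntegrable.const_mul ?_ 2
    rw [intervalIntegrable_iff_integrableOn_Ioc_of_le hst] at hG ⊢
    refine (hG.norm.const_mul M).mono' (((hZc.mono Ioc_subset_Icc_self).aestronglyMeasurable
      measurableSet_Ioc).inner hG.aestronglyMeasurable) ?_
    filter_upwards [ae_restrict_mem measurableSet_Ioc] with x hx
    exact (norm_inner_le_norm _ _).trans
      (mul_le_mul_of_nonneg_right (hM x (Ioc_subset_Icc_self hx)) (norm_nonneg _))
  have hac1 : AbsolutelyContinuousOnInterval (fun x => ‖Z x‖ ^ 2) s t := by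
    refine absolutelyContinuousOnInterval_of_dist_le
      ((hG.norm.absolutelyContinuousOnInterval_intervalIntegral
        (c := s) left_mem_uIcc).const_mul (2 * M)) ?_
    rw [huIcc]
    intro x hx y hy
    have h1 : Z x - Z y = ∫ r in y..x, G r := by
      simp only [hZ]
      rw [add_sub_add_left_eq_sub,
        intervalIntegral.integral_interval_sub_left (hsub _ ⟨le_rfl, hst⟩ _ hx)
          (hsub _ ⟨le_rfl, hst⟩ _ hy)]
    rw [Real.dist_eq, Real.dist_eq, ← mul_sub,
      intervalIntegral.integral_interval_sub_left (hsub _ ⟨le_rfl, hst⟩ _ hx).norm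
          (hsub _ ⟨le_rfl, hst⟩ _ hy).norm, abs_mul, abs_of_nonneg (by positivity : 0 ≤ 2 * M)]
    have h2 : |‖Z x‖ - ‖Z y‖| ≤ |∫ r in y..x, ‖G r‖| :=
      (abs_norm_sub_norm_le _ _).trans
        (h1 ▸ intervalIntegral.norm_integral_le_abs_integral_norm)
    rw [sq_sub_sq, abs_mul]
    gcongr
    rw [abs_of_nonneg (by positivity)]
    linarith [hM x hx, hM y hy]
  -- The primitive is differentiable only almost everywhere. Absolute continuity makes the
  -- difference of the two sides constant once its derivative vanishes almost everywhere.
  have hac := hac1.sub (hinner.absolutelyContinuousOnInterval_intervalIntegral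
    (c := s) left_mem_uIcc)
  obtain ⟨C, hC⟩ := hac.const_of_ae_hasDerivAt_zero (by
    filter_upwards [hG.ae_hasDerivAt_integral, hinner.ae_hasDerivAt_integral] with x h1 h2 hx
    have h3 : HasDerivAt Z (G x) x := (h1 hx s left_mem_uIcc).const_add (Y s)
    have h4 := h3.norm_sq.sub (h2 hx s left_mem_uIcc)
    simpa using h4)
  have e1 := hC t right_mem_uIcc
  have e2 := hC s left_mem_uIcc
  simp only [Pi.sub_apply, intervalIntegral.integral_same, sub_zero] at e1 e2
  rw [hYZ t ⟨hst, le_rfl⟩, hYZ s ⟨le_rfl, hst⟩, e2, ← e1, sub_sub_cancel]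
  refine intervalIntegral.integral_congr fun x hx => ?_
  rw [huIcc] at hx
  simp only [hYZ x hx]

end SquareNorm

/-! ### Exponential weights -/

section Weights

/-- Vanishing at `0` makes `f` the primitive of `g` starting from `0`, and integrability of `g`
makes that primitive converge at infinity. -/
theorem tendsto_atTop_integral_Ioi {E : Type*} [NormedAddCommGroup E] [NormedSpace ℝ E]
    {f g : ℝ → E} (hg : IntegrableOn g (Ioi 0))
    (hfg : ∀ s t, 0 < s → s ≤ t → ∫ x in s..t, g x = f t - f s)
    (hf : Tendsto f (𝓝[>] 0) (𝓝 0)) : Tendsto f atTop (𝓝 (∫ x in Ioi 0, g x)) := by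
  have hgi : ∀ t, 0 ≤ t → IntervalIntegrable g volume 0 t := fun t ht =>
    (intervalIntegrable_iff_integrableOn_Ioc_of_le ht).2 (hg.mono_set Ioc_subset_Ioi_self)
  have key : ∀ t, 0 < t → ∫ x in (0 : ℝ)..t, g x = f t := by
    intro t ht
    have h1 : Tendsto (fun s => ∫ x in (0 : ℝ)..s, g x) (𝓝[>] 0) (𝓝 0) := by
      have hc := (intervalIntegral.continuousOn_primitive_interval' (hgi t ht.le)
        left_mem_uIcc) 0 left_mem_uIcc
      rw [ContinuousWithinAt, intervalIntegral.integral_same, uIcc_of_le ht.le,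
        nhdsWithin_Icc_eq_nhdsGE ht] at hc
      exact hc.mono_left (nhdsWithin_mono _ Ioi_subset_Ici_self)
    have h2 : Tendsto (fun s => (∫ x in (0 : ℝ)..t, g x) - ∫ x in (0 : ℝ)..s, g x) (𝓝[>] 0)
        (𝓝 (f t)) := by
      have h3 : Tendsto (fun s => f t - f s) (𝓝[>] 0) (𝓝 (f t)) := by
        simpa using hf.const_sub (f t)
      refine h3.congr' ?_
      filter_upwards [self_mem_nhdsWithin, nhdsWithin_le_nhds (Iio_mem_nhds ht)] with s hs hst
      have hs' : 0 < s := hs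
      have hst' : s < t := hst
      rw [intervalIntegral.integral_interval_sub_left (hgi t ht.le) (hgi s hs'.le),
        hfg s t hs' hst'.le]
    have h4 := h1.const_sub (∫ x in (0 : ℝ)..t, g x)
    rw [sub_zero] at h4
    exact tendsto_nhds_unique h4 h2
  refine (intervalIntegral_tendsto_integral_Ioi 0 hg tendsto_id).congr' ?_
  filter_upwards [Ioi_mem_atTop 0] with t ht
  exact key t ht

theorem deriv_exp_neg_mul (a s : ℝ) :
    deriv (fun s => Real.exp (-(a * s))) s = -a * Real.exp (-(a * s)) := by
  have h : HasDerivAt (fun s => -(a * s)) (-a) s := by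
    simpa using ((hasDerivAt_id s).const_mul a).fun_neg
  rw [h.exp.deriv, mul_comm]

theorem contDiff_exp_neg_mul (a : ℝ) : ContDiff ℝ ∞ fun s : ℝ => Real.exp (-(a * s)) := by
  fun_prop

theorem tendsto_exp_neg_mul_smul {E : Type*} [NormedAddCommGroup E] [NormedSpace ℝ E]
    {y : ℝ → E} (h0 : Tendsto y (𝓝[>] 0) (𝓝 0)) (a : ℝ) :
    Tendsto (fun s => Real.exp (-(a * s)) • y s) (𝓝[>] 0) (𝓝 0) := by
  have h1 : Tendsto (fun s => Real.exp (-(a * s))) (𝓝[>] 0) (𝓝 (Real.exp (-(a * 0)))) :=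
    ((contDiff_exp_neg_mul a).continuous.tendsto 0).mono_left nhdsWithin_le_nhds
  simpa using h1.smul h0

theorem locallyIntegrableOn_of_exp_smul {E : Type*} [NormedAddCommGroup E] [NormedSpace ℝ E]
    {z : ℝ → E} {a : ℝ} (hz : IntegrableOn (fun s => Real.exp (-(a * s)) • z s) (Ioi 0)) :
    LocallyIntegrableOn z (Ioi 0) := by
  have h := LocallyIntegrableOn.continuousOn_smul (𝕜 := ℝ) (g := fun s => Real.exp (a * s))
    isOpen_Ioi.isLocallyClosed hz.locallyIntegrableOn (by fun_prop)
  simpa [smul_smul, ← Real.exp_add] using h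

variable {E : Type*} [NormedAddCommGroup E] [InnerProductSpace ℝ E] [CompleteSpace E]
  {y z : ℝ → E} {a : ℝ}

/-- Integration by parts against the exponential weight. -/
theorem integral_exp_smul_of_hasWeakDerivIoi (hw : HasWeakDerivIoi y fun s => -z s)
    (hy : ContinuousOn y (Ioi 0)) (h0 : Tendsto y (𝓝[>] 0) (𝓝 0))
    (iy : IntegrableOn (fun s => Real.exp (-(a * s)) • y s) (Ioi 0))
    (iz : IntegrableOn (fun s => Real.exp (-(a * s)) • z s) (Ioi 0)) :
    ∫ s in Ioi (0 : ℝ), Real.exp (-(a * s)) • z s =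
      -a • ∫ s in Ioi (0 : ℝ), Real.exp (-(a * s)) • y s := by
  have hz : LocallyIntegrableOn (fun s => -z s) (Ioi 0) := (locallyIntegrableOn_of_exp_smul iz).neg
  have hm := contDiff_exp_neg_mul a
  have hw' := hw.smul (hy.locallyIntegrableOn measurableSet_Ioi) hz hm
  have hfc : ContinuousOn (fun s => Real.exp (-(a * s)) • y s) (Ioi 0) :=
    hm.continuous.continuousOn.smul hy
  have e : (fun s => Real.exp (-(a * s)) • -z s + deriv (fun s => Real.exp (-(a * s))) s • y s) =
      fun s => -(Real.exp (-(a * s)) • z s) + -a • Real.exp (-(a * s)) • y s := by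
    funext s
    rw [deriv_exp_neg_mul, smul_neg, mul_smul]
  rw [e] at hw'
  have hgi : IntegrableOn (fun s => -(Real.exp (-(a * s)) • z s) +
      -a • Real.exp (-(a * s)) • y s) (Ioi 0) := iz.neg.add (iy.smul (-a))
  have hlim := tendsto_atTop_integral_Ioi hgi (fun s t hs hst => hw'.integral_eq_sub hfc
    hgi.locallyIntegrableOn hs hst) (tendsto_exp_neg_mul_smul h0 a)
  -- The boundary term at infinity vanishes: the weighted function has a limit there and is also
  -- integrable, while neighbourhoods of infinity have infinite measure.
  have hzero := IntegrableAtFilter.eq_zero_of_tendsto (μ := volume) (l := atTop)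
    ⟨Ioi 0, Ioi_mem_atTop 0, iy⟩ (fun s hs => by
      obtain ⟨b, hb⟩ := mem_atTop_sets.1 hs
      exact eq_top_mono (measure_mono hb) Real.volume_Ici) hlim
  have h1 : ∫ s in Ioi (0 : ℝ), (-(Real.exp (-(a * s)) • z s) + -a • Real.exp (-(a * s)) • y s) =
      -(∫ s in Ioi (0 : ℝ), Real.exp (-(a * s)) • z s) +
        -a • ∫ s in Ioi (0 : ℝ), Real.exp (-(a * s)) • y s := by
    have := integral_add iz.neg (iy.smul (-a))
    simpa only [Pi.neg_apply, Pi.smul_apply, integral_neg, integral_smul] using this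
  rw [hzero] at h1
  rw [eq_comm, ← sub_eq_zero, h1]
  abel

/-- Dissipativity of the right translations with respect to the exponential weight. -/
theorem integral_exp_mul_inner_le (hw : HasWeakDerivIoi y fun s => -z s)
    (hy : ContinuousOn y (Ioi 0)) (h0 : Tendsto y (𝓝[>] 0) (𝓝 0))
    (hz : LocallyIntegrableOn z (Ioi 0))
    (iy : IntegrableOn (fun s => Real.exp (-(a * s)) * ‖y s‖ ^ 2) (Ioi 0))
    (iz : IntegrableOn (fun s => Real.exp (-(a * s)) * inner ℝ (y s) (z s)) (Ioi 0)) :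
    2 * ∫ s in Ioi (0 : ℝ), Real.exp (-(a * s)) * inner ℝ (y s) (z s) ≤
      -a * ∫ s in Ioi (0 : ℝ), Real.exp (-(a * s)) * ‖y s‖ ^ 2 := by
  -- Half of the exponent is put on `y`, so that `‖m y‖²` carries the full weight. The integral of
  -- its derivative over the half line is its limit at infinity, of which only nonnegativity is
  -- used.
  set m : ℝ → ℝ := fun s => Real.exp (-(a / 2 * s)) with hmdef
  have hm : ContDiff ℝ ∞ m := contDiff_exp_neg_mul (a / 2)
  have hmm : ∀ s, m s * m s = Real.exp (-(a * s)) := fun s => by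
    rw [hmdef, ← Real.exp_add]
    congr 1
    ring
  have hyl := hy.locallyIntegrableOn measurableSet_Ioi (μ := volume)
  have hzn : LocallyIntegrableOn (fun s => -z s) (Ioi 0) := hz.neg
  have hw' := hw.smul hyl hzn hm
  have hfc : ContinuousOn (fun s => m s • y s) (Ioi 0) := hm.continuous.continuousOn.smul hy
  have hgl : LocallyIntegrableOn (fun s => m s • -z s + deriv m s • y s) (Ioi 0) :=
    (hzn.continuousOn_smul isOpen_Ioi.isLocallyClosed hm.continuous.continuousOn).add
      (hyl.continuousOn_smul isOpen_Ioi.isLocallyClosed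
        (hm.continuous_deriv (by simp)).continuousOn)
  have e : ∀ s, 2 * inner ℝ (m s • y s) (m s • -z s + deriv m s • y s) =
      -2 * (Real.exp (-(a * s)) * inner ℝ (y s) (z s)) -
        a * (Real.exp (-(a * s)) * ‖y s‖ ^ 2) := fun s => by
    rw [show deriv m s = -(a / 2) * m s from deriv_exp_neg_mul (a / 2) s, ← hmm]
    simp only [inner_add_right, inner_smul_left, inner_smul_right, inner_neg_right,
      real_inner_self_eq_norm_sq, RCLike.conj_to_real]
    ring
  have hgi : IntegrableOn (fun s => 2 * inner ℝ (m s • y s) (m s • -z s + deriv m s • y s))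
      (Ioi 0) := by
    simp only [e]
    exact (iz.const_mul (-2)).sub (iy.const_mul a)
  have hlim := tendsto_atTop_integral_Ioi (f := fun s => ‖m s • y s‖ ^ 2) hgi
    (fun s t hs hst => norm_sq_sub_norm_sq_eq_integral hst
      ((intervalIntegrable_iff_integrableOn_Icc_of_le hst).2 (hgl.integrableOn_compact_subset
        (fun x hx => mem_Ioi.2 (hs.trans_le hx.1)) isCompact_Icc))
      fun x hx => hw'.integral_eq_sub hfc hgl hs hx.1)
    (by simpa using (tendsto_exp_neg_mul_smul h0 (a / 2)).norm.pow 2)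
  have hnn := ge_of_tendsto' hlim fun s => by positivity
  simp only [e] at hnn
  rw [integral_sub (iz.const_mul (-2)) (iy.const_mul a), integral_const_mul,
    integral_const_mul] at hnn
  linarith

end Weights

/-! ### The memory space -/

section Memory

variable {p : Params}

/-- The derivative as an operator on `H¹₀`. -/
def dxH01 (ℓ : ℝ) : H01 ℓ →L[ℝ] L2 ℓ :=
  (WithLp.sndL 2 ℝ (L2 ℓ) (L2 ℓ)).comp (H01 ℓ).subtypeL

theorem dxH01_apply {ℓ : ℝ} (u : H01 ℓ) : dxH01 ℓ u = dx (u : L2Pair ℓ) := rfl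

/-- The derivative in `x` of elements of the memory space. -/
def dxMem (p : Params) : Mem p →L[ℝ] Lp (L2 p.ℓ) 2 (memMeasure p) :=
  (dxH01 p.ℓ).compLpL 2 (memMeasure p)

theorem dxMem_ae (η : Mem p) :
    dxMem p η =ᵐ[memMeasure p] fun s => dx (η s : L2Pair p.ℓ) :=
  (dxH01 p.ℓ).coeFn_compLpL η

theorem kernel_eq (p : Params) (s : ℝ) :
    kernel p s = (p.β / p.τ) ^ 2 * Real.exp (-(p.β / p.τ * s)) := by
  rw [kernel, div_pow]
  congr 3
  ring

theorem kernel_pos (p : Params) (s : ℝ) : 0 < kernel p s := by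
  rw [kernel_eq]
  have := p.β_pos
  have := p.τ_pos
  positivity

theorem continuous_kernel (p : Params) : Continuous (kernel p) := by
  unfold kernel
  fun_prop

theorem integral_memMeasure {E : Type*} [NormedAddCommGroup E] [NormedSpace ℝ E] (f : ℝ → E) :
    ∫ s, f s ∂(memMeasure p) =
      (p.β / p.τ) ^ 2 • ∫ s in Ioi (0 : ℝ), Real.exp (-(p.β / p.τ * s)) • f s := by
  rw [memMeasure, integral_withDensity_eq_integral_toReal_smul
    (continuous_kernel p).measurable.ennreal_ofReal (by simp), ← integral_smul]
  refine integral_congr_ae (Eventually.of_forall fun s => ?_)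
  simp only
  rw [ENNReal.toReal_ofReal (kernel_pos p s).le, kernel_eq, mul_smul]

theorem integrable_memMeasure_iff {E : Type*} [NormedAddCommGroup E] [NormedSpace ℝ E]
    {f : ℝ → E} : Integrable f (memMeasure p) ↔
      IntegrableOn (fun s => Real.exp (-(p.β / p.τ * s)) • f s) (Ioi 0) := by
  have hc : (p.β / p.τ) ^ 2 ≠ 0 := pow_ne_zero _ (div_pos p.β_pos p.τ_pos).ne'
  rw [memMeasure, integrable_withDensity_iff_integrable_smul'
    (continuous_kernel p).measurable.ennreal_ofReal (by simp), IntegrableOn]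
  refine Iff.trans ?_ (integrable_smul_iff hc _)
  refine integrable_congr (Eventually.of_forall fun s => ?_)
  simp only [Pi.smul_apply]
  rw [ENNReal.toReal_ofReal (kernel_pos p s).le, kernel_eq, mul_smul]

/-- The kernel is positive everywhere, so the two measures have the same null sets. Weak derivatives
are tested with Lebesgue measure, while memory elements are classes for `μ(s) ds`. -/
theorem ae_memMeasure_iff {P : ℝ → Prop} :
    (∀ᵐ s ∂(memMeasure p), P s) ↔ ∀ᵐ s ∂(volume.restrict (Ioi 0)), P s := by
  have h1 : memMeasure p ≪ volume.restrict (Ioi 0) := withDensity_absolutelyContinuous _ _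
  have h2 : volume.restrict (Ioi 0) ≪ memMeasure p :=
    withDensity_absolutelyContinuous' (continuous_kernel p).measurable.ennreal_ofReal.aemeasurable
      (Eventually.of_forall fun s => by simpa using kernel_pos p s)
  exact ⟨fun h => h2.ae_le h, fun h => h1.ae_le h⟩

theorem integral_exp_neg_mul {a : ℝ} (ha : 0 < a) :
    ∫ s in Ioi (0 : ℝ), Real.exp (-(a * s)) = 1 / a := by
  have := integral_exp_mul_Ioi (a := -a) (by linarith) 0
  simpa [neg_mul, div_neg, neg_div] using this

instance (p : Params) : IsFiniteMeasure (memMeasure p) := by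
  have h : Integrable (fun _ : ℝ => (1 : ℝ)) (memMeasure p) := by
    rw [integrable_memMeasure_iff]
    have := integrableOn_exp_mul_Ioi (a := -(p.β / p.τ))
      (by have := div_pos p.β_pos p.τ_pos; linarith) 0
    simpa [neg_mul] using this
  simpa [integrable_const_iff, isFiniteMeasure_iff] using h

theorem memMeasure_real_univ (p : Params) : (memMeasure p).real univ = p.β / p.τ := by
  have h : ∫ _, (1 : ℝ) ∂(memMeasure p) = p.β / p.τ := by
    have ha := div_pos p.β_pos p.τ_pos
    rw [integral_memMeasure]
    simp only [smul_eq_mul, mul_one]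
    rw [integral_exp_neg_mul ha]
    field_simp
  simpa using h

theorem integrable_mem {E : Type*} [NormedAddCommGroup E] (η : Lp E 2 (memMeasure p)) :
    Integrable η (memMeasure p) :=
  (Lp.memLp η).integrable one_le_two

theorem memNormSq_eq (η : Mem p) : memNormSq p η = ‖dxMem p η‖ ^ 2 := by
  rw [← real_inner_self_eq_norm_sq, L2.inner_def, memNormSq]
  refine integral_congr_ae ?_
  filter_upwards [dxMem_ae η] with s hs
  rw [hs, real_inner_self_eq_norm_sq]

theorem dx_integral (η : Mem p) :
    dx ((∫ s, η s ∂(memMeasure p) : H01 p.ℓ) : L2Pair p.ℓ) =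
      ∫ s, dx (η s : L2Pair p.ℓ) ∂(memMeasure p) :=
  ((dxH01 p.ℓ).integral_comp_comm (integrable_mem η)).symm

theorem integrable_dx (η : Mem p) :
    Integrable (fun s => dx (η s : L2Pair p.ℓ)) (memMeasure p) :=
  (dxH01 p.ℓ).integrable_comp (integrable_mem η)

theorem locallyIntegrableOn_mem {E : Type*} [NormedAddCommGroup E] [NormedSpace ℝ E]
    {f : ℝ → E} (hf : Integrable f (memMeasure p)) : LocallyIntegrableOn f (Ioi 0) :=
  locallyIntegrableOn_of_exp_smul (integrable_memMeasure_iff.1 hf)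

theorem HasWeakDerivMem.hasWeakDerivIoi {η ξ : Mem p} (h : HasWeakDerivMem p η ξ) :
    HasWeakDerivIoi (fun s => dx (η s : L2Pair p.ℓ)) (fun s => dx (ξ s : L2Pair p.ℓ)) := by
  intro χ hχ
  have i1 : IntegrableOn (fun s => deriv χ s • η s) (Ioi 0) :=
    IsTest.integrableOn_smul hχ.continuous_deriv hχ.2.1.deriv
      (tsupport_deriv_subset.trans hχ.2.2) (locallyIntegrableOn_mem (integrable_mem η))
  have i2 : IntegrableOn (fun s => χ s • ξ s) (Ioi 0) :=
    IsTest.integrableOn_smul hχ.continuous hχ.2.1 hχ.2.2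
      (locallyIntegrableOn_mem (integrable_mem ξ))
  have := congrArg (dxH01 p.ℓ) (h χ hχ)
  rw [map_neg, ← ContinuousLinearMap.integral_comp_comm _ i1,
    ← ContinuousLinearMap.integral_comp_comm _ i2] at this
  simpa only [map_smul, dxH01_apply] using this

/-- The continuous representative of the derivative in `x` of an element of the domain of `T`. -/
theorem IsT.exists_rep {η ζ : Mem p} (h : IsT p η ζ) : ∃ y : ℝ → L2 p.ℓ,
    ContinuousOn y (Ioi 0) ∧ Tendsto y (𝓝[>] 0) (𝓝 0) ∧
    (∀ᵐ s ∂(memMeasure p), dx (η s : L2Pair p.ℓ) = y s) ∧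
    HasWeakDerivIoi y fun s => -dx (ζ s : L2Pair p.ℓ) := by
  obtain ⟨hw, η', hc, hae, h0⟩ := h
  have hae' : ∀ᵐ s ∂(memMeasure p), dx (η s : L2Pair p.ℓ) = dx (η' s : L2Pair p.ℓ) := by
    filter_upwards [hae] with s hs
    rw [hs]
  refine ⟨fun s => dx (η' s : L2Pair p.ℓ), (dxH01 p.ℓ).continuous.comp_continuousOn hc,
    tendsto_zero_iff_norm_tendsto_zero.2 h0, hae', fun χ hχ => ?_⟩
  have h1 := hw.hasWeakDerivIoi χ hχ
  have e1 : ∫ s in Ioi (0 : ℝ), deriv χ s • dx (η' s : L2Pair p.ℓ) =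
      ∫ s in Ioi (0 : ℝ), deriv χ s • dx (η s : L2Pair p.ℓ) := by
    refine integral_congr_ae ?_
    filter_upwards [ae_memMeasure_iff.1 hae'] with s hs
    rw [hs]
  have e2 : ∫ s in Ioi (0 : ℝ), χ s • -dx (ζ s : L2Pair p.ℓ) =
      ∫ s in Ioi (0 : ℝ), χ s • dx ((-ζ : Mem p) s : L2Pair p.ℓ) := by
    refine integral_congr_ae ?_
    filter_upwards [ae_memMeasure_iff.1 (Lp.coeFn_neg ζ)] with s hs
    rw [hs]
    rfl
  rw [e1, e2, h1]

/-- The exponential form of the kernel enters here: moving `-D` onto `μ` returns a multiple of `μ`,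
so the equation for the averaged memory closes. -/
theorem IsT.dx_integral_eq {η ζ : Mem p} (h : IsT p η ζ) :
    ∫ s, dx (ζ s : L2Pair p.ℓ) ∂(memMeasure p) =
      -(p.β / p.τ) • ∫ s, dx (η s : L2Pair p.ℓ) ∂(memMeasure p) := by
  obtain ⟨y, hy, h0, hae, hw⟩ := h.exists_rep
  have iy : Integrable y (memMeasure p) := (integrable_dx η).congr hae
  rw [integral_congr_ae hae, integral_memMeasure, integral_memMeasure,
    integral_exp_smul_of_hasWeakDerivIoi hw hy h0 (integrable_memMeasure_iff.1 iy)
      (integrable_memMeasure_iff.1 (integrable_dx ζ)), smul_comm]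

/-- Formally `-∫ μ (‖ηₓ‖²)' = ∫ μ' ‖ηₓ‖² - lim μ‖ηₓ‖²` with `μ' = -(β/τ)μ`; the term at `0` vanishes
by the domain condition and the one at infinity has the good sign. -/
theorem IsT.inner_le {η ζ : Mem p} (h : IsT p η ζ) :
    2 * inner ℝ (dxMem p η) (dxMem p ζ) ≤ -(p.β / p.τ) * ‖dxMem p η‖ ^ 2 := by
  obtain ⟨y, hy, h0, hae, hw⟩ := h.exists_rep
  have ha : ∀ᵐ s ∂(memMeasure p), inner ℝ (dxMem p η s) (dxMem p ζ s) =
      inner ℝ (y s) (dx (ζ s : L2Pair p.ℓ)) := by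
    filter_upwards [dxMem_ae η, dxMem_ae ζ, hae] with s h1 h2 h3
    rw [h1, h2, h3]
  have hb : ∀ᵐ s ∂(memMeasure p), inner ℝ (dxMem p η s) (dxMem p η s) = ‖y s‖ ^ 2 := by
    filter_upwards [dxMem_ae η, hae] with s h1 h3
    rw [h1, h3, real_inner_self_eq_norm_sq]
  have i1 := integrable_memMeasure_iff.1 ((L2.integrable_inner (𝕜 := ℝ) _ _).congr ha)
  have i2 := integrable_memMeasure_iff.1 ((L2.integrable_inner (𝕜 := ℝ) _ _).congr hb)
  have key := integral_exp_mul_inner_le hw hy h0 (locallyIntegrableOn_mem (integrable_dx ζ)) i2 i1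
  rw [← real_inner_self_eq_norm_sq, L2.inner_def, L2.inner_def, integral_congr_ae ha,
    integral_congr_ae hb, integral_memMeasure, integral_memMeasure]
  simp only [smul_eq_mul]
  nlinarith [sq_nonneg (p.β / p.τ)]

end Memory

/-! ### Completeness and integration by parts on the beam -/

section Beam

variable {ℓ : ℝ}

theorem inner_toLp (f : L2 ℓ) {φ : ℝ → ℝ} (h : MemLp φ 2 (beam ℓ)) :
    inner ℝ f (h.toLp φ) = ∫ x in Ioo 0 ℓ, f x * φ x := by
  rw [L2.inner_def]
  refine integral_congr_ae ?_
  filter_upwards [h.coeFn_toLp] with x hx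
  rw [hx, RCLike.inner_apply, RCLike.conj_to_real, mul_comm]

/-- The function of a pair as an operator. -/
def fnL (ℓ : ℝ) : L2Pair ℓ →L[ℝ] L2 ℓ := WithLp.fstL 2 ℝ (L2 ℓ) (L2 ℓ)

/-- The derivative of a pair as an operator. -/
def dxL (ℓ : ℝ) : L2Pair ℓ →L[ℝ] L2 ℓ := WithLp.sndL 2 ℝ (L2 ℓ) (L2 ℓ)

/-- Each test function imposes one equation between continuous linear functionals of the pair.
Closedness gives the completeness of the phase spaces on which uniform boundedness relies. -/
theorem isClosed_H1 (ℓ : ℝ) : IsClosed (H1 ℓ : Set (L2Pair ℓ)) := by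
  have h : (H1 ℓ : Set (L2Pair ℓ)) = ⋂ φ : {φ : ℝ → ℝ // IsTest (Ioo 0 ℓ) φ},
      {u | inner ℝ (fnL ℓ u) (φ.2.memLp_deriv.toLp (deriv φ.1)) =
        -inner ℝ (dxL ℓ u) (φ.2.memLp.toLp φ.1)} := by
    ext u
    simp only [mem_iInter, mem_ofPred_eq, inner_toLp, Subtype.forall]
    rfl
  rw [h]
  exact isClosed_iInter fun φ => isClosed_eq (by fun_prop) (by fun_prop)

theorem isClosed_L2star (ℓ : ℝ) : IsClosed (L2star ℓ : Set (L2 ℓ)) := by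
  have h : (L2star ℓ : Set (L2 ℓ)) =
      {f | inner ℝ f ((memLp_const (μ := beam ℓ) (p := 2) (1 : ℝ)).toLp _) = 0} := by
    ext f
    simp only [mem_ofPred_eq, inner_toLp, mul_one]
    rfl
  rw [h]
  exact isClosed_eq (by fun_prop) continuous_const

theorem isClosed_H1star (ℓ : ℝ) : IsClosed (H1star ℓ : Set (L2Pair ℓ)) :=
  (isClosed_H1 ℓ).inter ((isClosed_L2star ℓ).preimage (fnL ℓ).continuous)

instance (ℓ : ℝ) : CompleteSpace (L2star ℓ) := (isClosed_L2star ℓ).completeSpace_coe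

instance (ℓ : ℝ) : CompleteSpace (H1star ℓ) := (isClosed_H1star ℓ).completeSpace_coe

/-- For a test function `v` this is the definition of the weak derivative of `u`. Both sides are
continuous in `v` for the `H¹` norm, so the identity passes to the closure, with no boundary terms.
-/
theorem inner_fn_dx {u v : L2Pair ℓ} (hu : u ∈ H1 ℓ) (hv : v ∈ H01 ℓ) :
    inner ℝ (fn u) (dx v) = -inner ℝ (dx u) (fn v) := by
  set L : L2Pair ℓ →L[ℝ] ℝ :=
    (innerSL ℝ (fn u)).comp (dxL ℓ) + (innerSL ℝ (dx u)).comp (fnL ℓ) with hL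
  have hLv : ∀ v, L v = inner ℝ (fn u) (dx v) + inner ℝ (dx u) (fn v) := fun v => rfl
  have hle : H01 ℓ ≤ LinearMap.ker L.toLinearMap := by
    refine Submodule.topologicalClosure_minimal _ (Submodule.span_le.2 ?_) L.isClosed_ker
    rintro _ ⟨φ, rfl⟩
    have h1 : inner ℝ (fn u) (φ.2.memLp_deriv.toLp (deriv φ.1)) =
        -inner ℝ (dx u) (φ.2.memLp.toLp φ.1) := by
      rw [inner_toLp, inner_toLp]
      exact hu φ.1 φ.2
    change L (testPair φ) = 0
    rw [hLv]
    change inner ℝ (fn u) (φ.2.memLp_deriv.toLp (deriv φ.1)) +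
      inner ℝ (dx u) (φ.2.memLp.toLp φ.1) = 0
    rw [h1, neg_add_cancel]
  have := hle hv
  change L v = 0 at this
  rw [hLv] at this
  linarith

end Beam

/-! ### From the Gurtin-Pipkin system to the Cattaneo system -/

section Reduction

variable {p : Params}

/-- Cauchy–Schwarz against the constant function equal to the integral itself; the constant `β/τ` is
the mass of `μ`. -/
theorem norm_integral_sq_le {E : Type*} [NormedAddCommGroup E] [InnerProductSpace ℝ E]
    [CompleteSpace E] (f : Lp E 2 (memMeasure p)) :
    ‖∫ s, f s ∂(memMeasure p)‖ ^ 2 ≤ p.β / p.τ * ‖f‖ ^ 2 := by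
  set c := ∫ s, f s ∂(memMeasure p)
  set g : Lp E 2 (memMeasure p) := Lp.const 2 (memMeasure p) c
  have hg : g =ᵐ[memMeasure p] fun _ => c := Lp.coeFn_const 2 (memMeasure p) c
  have h0 := div_pos p.β_pos p.τ_pos
  have h1 : inner ℝ g f = ‖c‖ ^ 2 := by
    rw [L2.inner_def, ← real_inner_self_eq_norm_sq, ← integral_inner (integrable_mem f)]
    refine integral_congr_ae ?_
    filter_upwards [hg] with s hs
    rw [hs]
  have h2 : ‖g‖ ^ 2 = p.β / p.τ * ‖c‖ ^ 2 := by
    have h3 : ∫ s, inner ℝ (g s) (g s) ∂(memMeasure p) = ∫ _, ‖c‖ ^ 2 ∂(memMeasure p) := by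
      refine integral_congr_ae ?_
      filter_upwards [hg] with s hs
      rw [hs, real_inner_self_eq_norm_sq]
    rw [← real_inner_self_eq_norm_sq, L2.inner_def, h3, integral_const, memMeasure_real_univ,
      smul_eq_mul]
  have h3 := real_inner_le_norm g f
  rw [h1] at h3
  by_cases hc : ‖c‖ = 0
  · rw [hc, zero_pow two_ne_zero]
    positivity
  · have hc' : 0 < ‖c‖ ^ 2 := by positivity
    have h4 : (‖c‖ ^ 2) ^ 2 ≤ (p.β / p.τ * ‖c‖ ^ 2) * ‖f‖ ^ 2 := by
      rw [← h2, ← mul_pow]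
      gcongr
    nlinarith

/-- The integral over the memory variable, as an operator. -/
def memIntegral (p : Params) (E : Type*) [NormedAddCommGroup E] [InnerProductSpace ℝ E]
    [CompleteSpace E] : Lp E 2 (memMeasure p) →L[ℝ] E :=
  LinearMap.mkContinuous
    { toFun := fun f => ∫ s, f s ∂(memMeasure p)
      map_add' := fun f g => by
        rw [← integral_add (integrable_mem f) (integrable_mem g)]
        exact integral_congr_ae (Lp.coeFn_add f g)
      map_smul' := fun c f => by
        rw [RingHom.id_apply, ← integral_smul]
        exact integral_congr_ae (Lp.coeFn_smul c f) }
    (Real.sqrt (p.β / p.τ)) fun f => by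
      have h0 := div_pos p.β_pos p.τ_pos
      refine (sq_le_sq₀ (norm_nonneg _)
        (mul_nonneg (Real.sqrt_nonneg _) (norm_nonneg _))).1 ?_
      rw [mul_pow, Real.sq_sqrt h0.le]
      exact norm_integral_sq_le f

theorem memIntegral_dxMem (η : Mem p) :
    memIntegral p (L2 p.ℓ) (dxMem p η) = ∫ s, dx (η s : L2Pair p.ℓ) ∂(memMeasure p) :=
  integral_congr_ae (dxMem_ae η)

/-- The map `(u, η) ↦ (u, q)`, where `q = -(1/β) ∫ μ(s) ηₓ(s) ds` is the heat flux. -/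
def flux (p : Params) : GPSpace p →L[ℝ] CatSpace p :=
  (ContinuousLinearMap.fst ℝ (Phase5 p) (Mem p)).prod
    ((-(1 / p.β)) • (((memIntegral p (L2 p.ℓ)).comp (dxMem p)).comp
      (ContinuousLinearMap.snd ℝ (Phase5 p) (Mem p))))

theorem flux_apply (z : GPSpace p) :
    flux p z = (z.1, -(1 / p.β) • memIntegral p (L2 p.ℓ) (dxMem p z.2)) := rfl

/-- The constants match exactly: `τ · β⁻² · (β/τ) = 1/β`, the weight of the memory in the
Gurtin–Pipkin norm. -/
theorem catNorm_flux_le (z : GPSpace p) : catNorm p (flux p z) ≤ gpNorm p z := by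
  refine Real.sqrt_le_sqrt ?_
  rw [flux_apply, memNormSq_eq]
  have hβ := p.β_pos
  have hτ := p.τ_pos
  have h := norm_integral_sq_le (dxMem p z.2)
  change ‖memIntegral p (L2 p.ℓ) (dxMem p z.2)‖ ^ 2 ≤ _ at h
  simp only [norm_smul, mul_pow, norm_neg, Real.norm_eq_abs, sq_abs]
  have h1 : p.τ * ((1 / p.β) ^ 2 * ‖memIntegral p (L2 p.ℓ) (dxMem p z.2)‖ ^ 2) ≤
      p.τ * ((1 / p.β) ^ 2 * (p.β / p.τ * ‖dxMem p z.2‖ ^ 2)) := by gcongr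
  have h2 : p.τ * ((1 / p.β) ^ 2 * (p.β / p.τ * ‖dxMem p z.2‖ ^ 2)) =
      1 / p.β * ‖dxMem p z.2‖ ^ 2 := by field_simp
  linarith

theorem integral_dx_add {w ζ : Mem p} {θ : H01 p.ℓ}
    (h : w =ᵐ[memMeasure p] fun s => ζ s + θ) :
    ∫ s, dx (w s : L2Pair p.ℓ) ∂(memMeasure p) =
      (∫ s, dx (ζ s : L2Pair p.ℓ) ∂(memMeasure p)) + (p.β / p.τ) • dx (θ : L2Pair p.ℓ) := by
  have e : ∫ s, dx (w s : L2Pair p.ℓ) ∂(memMeasure p) =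
      ∫ s, (dx (ζ s : L2Pair p.ℓ) + dx (θ : L2Pair p.ℓ)) ∂(memMeasure p) := by
    refine integral_congr_ae ?_
    filter_upwards [h] with s hs
    rw [hs]
    rfl
  rw [e, integral_add (integrable_dx ζ) (integrable_const _), integral_const,
    memMeasure_real_univ]

/-- The flux map intertwines the two generators. -/
theorem gpGraph.catGraph_flux {z w : GPSpace p} (h : gpGraph p z w) :
    catGraph p (flux p z) (flux p w) := by
  obtain ⟨θ, hm, ⟨ζx, hζ, hθ⟩, ζ, hT, hw⟩ := h
  have hβ := p.β_pos.ne'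
  have hτ := p.τ_pos.ne'
  have hρ := p.ρ₃_pos.ne'
  have hfn : fn ((-(1 / p.β) • ζx : H1 p.ℓ) : L2Pair p.ℓ) = -(1 / p.β) • fn (ζx : L2Pair p.ℓ) :=
    map_smul (fnL p.ℓ) (-(1 / p.β)) (ζx : L2Pair p.ℓ)
  have hdx : dx ((-(1 / p.β) • ζx : H1 p.ℓ) : L2Pair p.ℓ) = -(1 / p.β) • dx (ζx : L2Pair p.ℓ) :=
    map_smul (dxL p.ℓ) (-(1 / p.β)) (ζx : L2Pair p.ℓ)
  rw [flux_apply, flux_apply]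
  refine ⟨θ, hm, (-(1 / p.β)) • ζx, ?_, ?_, ?_⟩
  · rw [hfn, hζ, memIntegral_dxMem, dx_integral]
  · rw [hdx, hθ, smul_smul]
    congr 2
    field_simp
  · simp only
    rw [memIntegral_dxMem, memIntegral_dxMem, integral_dx_add hw, hT.dx_integral_eq, smul_add,
      smul_smul, smul_smul, smul_smul, sub_eq_add_neg, ← neg_smul]
    congr 2 <;> field_simp

end Reduction

/-! ### The energy identity -/

section Energy

variable {p : Params}

open Phase5

/-- The inner product of the phase space of the Timoshenko-Gurtin-Pipkin system. -/
def gpInner (p : Params) (z w : GPSpace p) : ℝ :=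
  p.κ * inner ℝ (dx (phi z.1) + fn (psi z.1)) (dx (phi w.1) + fn (psi w.1))
    + p.ρ₁ * inner ℝ (phit z.1) (phit w.1) + p.b * inner ℝ (dx (psi z.1)) (dx (psi w.1))
    + p.ρ₂ * inner ℝ (psit z.1) (psit w.1) + p.ρ₃ * inner ℝ (theta z.1) (theta w.1)
    + 1 / p.β * inner ℝ (dxMem p z.2) (dxMem p w.2)

theorem energy_nonneg (u : Phase5 p) : 0 ≤ energy u := by
  have := p.κ_pos
  have := p.ρ₁_pos
  have := p.b_pos
  have := p.ρ₂_pos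
  have := p.ρ₃_pos
  unfold energy
  positivity

theorem memNormSq_nonneg (η : Mem p) : 0 ≤ memNormSq p η := by
  rw [memNormSq_eq]
  positivity

theorem gpNorm_sq (z : GPSpace p) :
    gpNorm p z ^ 2 = energy z.1 + 1 / p.β * memNormSq p z.2 := by
  have h1 := energy_nonneg z.1
  have h2 := memNormSq_nonneg z.2
  have := p.β_pos
  exact Real.sq_sqrt (by positivity)

theorem energy_le_catNorm_sq (z : CatSpace p) : energy z.1 ≤ catNorm p z ^ 2 := by
  have h1 := energy_nonneg z.1
  have := p.τ_pos
  rw [catNorm, Real.sq_sqrt (by positivity)]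
  have : 0 ≤ p.τ * ‖z.2‖ ^ 2 := by positivity
  linarith

/-- The strain `φₓ + ψ` as an operator. -/
def strainL (p : Params) : Phase5 p →L[ℝ] L2 p.ℓ :=
  ((dxL p.ℓ).comp ((H01 p.ℓ).subtypeL.comp (ContinuousLinearMap.fst ℝ _ _))) +
    (fnL p.ℓ).comp ((H1star p.ℓ).subtypeL.comp ((ContinuousLinearMap.fst ℝ _ _).comp
      ((ContinuousLinearMap.snd ℝ _ _).comp (ContinuousLinearMap.snd ℝ _ _))))

/-- The component `φ̃` as an operator. -/
def phitL (p : Params) : Phase5 p →L[ℝ] L2 p.ℓ :=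
  (ContinuousLinearMap.fst ℝ _ _).comp (ContinuousLinearMap.snd ℝ _ _)

/-- The derivative `ψₓ` as an operator. -/
def dxpsiL (p : Params) : Phase5 p →L[ℝ] L2 p.ℓ :=
  (dxL p.ℓ).comp ((H1star p.ℓ).subtypeL.comp ((ContinuousLinearMap.fst ℝ _ _).comp
    ((ContinuousLinearMap.snd ℝ _ _).comp (ContinuousLinearMap.snd ℝ _ _))))

/-- The component `ψ̃` as an operator. -/
def psitL (p : Params) : Phase5 p →L[ℝ] L2 p.ℓ :=
  (L2star p.ℓ).subtypeL.comp ((ContinuousLinearMap.fst ℝ _ _).comp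
    ((ContinuousLinearMap.snd ℝ _ _).comp
      ((ContinuousLinearMap.snd ℝ _ _).comp (ContinuousLinearMap.snd ℝ _ _))))

/-- The component `θ` as an operator. -/
def thetaL (p : Params) : Phase5 p →L[ℝ] L2 p.ℓ :=
  (ContinuousLinearMap.snd ℝ _ _).comp ((ContinuousLinearMap.snd ℝ _ _).comp
    ((ContinuousLinearMap.snd ℝ _ _).comp (ContinuousLinearMap.snd ℝ _ _)))

theorem energy_eq (u : Phase5 p) : energy u = p.κ * ‖strainL p u‖ ^ 2 + p.ρ₁ * ‖phitL p u‖ ^ 2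
    + p.b * ‖dxpsiL p u‖ ^ 2 + p.ρ₂ * ‖psitL p u‖ ^ 2 + p.ρ₃ * ‖thetaL p u‖ ^ 2 := rfl

theorem gpNorm_sq_eq (z : GPSpace p) : gpNorm p z ^ 2 = p.κ * ‖strainL p z.1‖ ^ 2
    + p.ρ₁ * ‖phitL p z.1‖ ^ 2 + p.b * ‖dxpsiL p z.1‖ ^ 2 + p.ρ₂ * ‖psitL p z.1‖ ^ 2
    + p.ρ₃ * ‖thetaL p z.1‖ ^ 2 + 1 / p.β * ‖dxMem p z.2‖ ^ 2 := by
  rw [gpNorm_sq, energy_eq, memNormSq_eq]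

theorem gpInner_eq (z w : GPSpace p) : gpInner p z w =
    p.κ * inner ℝ (strainL p z.1) (strainL p w.1) + p.ρ₁ * inner ℝ (phitL p z.1) (phitL p w.1)
    + p.b * inner ℝ (dxpsiL p z.1) (dxpsiL p w.1) + p.ρ₂ * inner ℝ (psitL p z.1) (psitL p w.1)
    + p.ρ₃ * inner ℝ (thetaL p z.1) (thetaL p w.1)
    + 1 / p.β * inner ℝ (dxMem p z.2) (dxMem p w.2) := rfl

theorem continuous_gpNorm (p : Params) : Continuous (gpNorm p) := by
  have : gpNorm p = fun z : GPSpace p => Real.sqrt (p.κ * ‖strainL p z.1‖ ^ 2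
      + p.ρ₁ * ‖phitL p z.1‖ ^ 2 + p.b * ‖dxpsiL p z.1‖ ^ 2 + p.ρ₂ * ‖psitL p z.1‖ ^ 2
      + p.ρ₃ * ‖thetaL p z.1‖ ^ 2 + 1 / p.β * ‖dxMem p z.2‖ ^ 2) := by
    funext z
    rw [gpNorm, energy_eq, memNormSq_eq]
  rw [this]
  fun_prop

/-- Separates the transport part from the coupling with the temperature, which sees the memory only
through its average. -/
theorem inner_dxMem_add {η w ζ : Mem p} {θ : H01 p.ℓ}
    (h : w =ᵐ[memMeasure p] fun s => ζ s + θ) :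
    inner ℝ (dxMem p η) (dxMem p w) = inner ℝ (dxMem p η) (dxMem p ζ) +
      inner ℝ (dx (θ : L2Pair p.ℓ)) (∫ s, dx (η s : L2Pair p.ℓ) ∂(memMeasure p)) := by
  rw [← integral_inner (integrable_dx η), L2.inner_def, L2.inner_def, ← integral_add
    (L2.integrable_inner _ _) ((integrable_dx η).const_inner _)]
  refine integral_congr_ae ?_
  filter_upwards [h, dxMem_ae η, dxMem_ae w, dxMem_ae ζ] with s h1 h2 h3 h4
  rw [h2, h3, h4, h1, real_inner_comm _ (dx (θ : L2Pair p.ℓ)), ← inner_add_right]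
  rfl

/-- The dissipation of the energy of the Timoshenko-Gurtin-Pipkin system. -/
theorem gpGraph.gpInner_le {z w : GPSpace p} (h : gpGraph p z w) :
    2 * gpInner p z w ≤ -(p.β / p.τ) * (1 / p.β * memNormSq p z.2) := by
  obtain ⟨θ, ⟨h1, h2, ⟨φx, h3, h4⟩, h5, ψx, h6, h7⟩, ⟨ζx, h8, h9⟩, ζ, hT, hw⟩ := h
  have hβ := p.β_pos
  have hin := mul_le_mul_of_nonneg_left hT.inner_le (by positivity : 0 ≤ 1 / p.β)
  rw [memNormSq_eq]
  have hz : (psi z.1) ∈ H1 p.ℓ := (z.1.2.2.1).2.1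
  have hwψ : (psi w.1) ∈ H1 p.ℓ := (w.1.2.2.1).2.1
  have hwφ : (phi w.1) ∈ H01 p.ℓ := (w.1.1).2
  -- In each pairing the second factor (`φ̃`, `ψₓ` or `θ`) lies in `H¹₀`, so the boundary terms
  -- vanish although the first factor is only in `H¹`.
  have ibp1 := inner_fn_dx φx.2 hwφ
  have ibp2 := inner_fn_dx hz hwφ
  have ibp3 := inner_fn_dx hwψ ψx.2
  have ibp4 := inner_fn_dx hwψ θ.2
  have ibp5 := inner_fn_dx ζx.2 θ.2
  rw [h8, dx_integral] at ibp5
  rw [h3, h2] at ibp1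
  rw [h2] at ibp2
  rw [h5, h6] at ibp3
  rw [h5, h1] at ibp4
  rw [h1] at ibp5
  have hκ : p.ρ₁ * (p.κ / p.ρ₁) = p.κ := mul_div_cancel₀ _ p.ρ₁_pos.ne'
  have hb : p.ρ₂ * (p.b / p.ρ₂) = p.b := mul_div_cancel₀ _ p.ρ₂_pos.ne'
  have hκ2 : p.ρ₂ * (p.κ / p.ρ₂) = p.κ := mul_div_cancel₀ _ p.ρ₂_pos.ne'
  have hδ : p.ρ₂ * (p.δ / p.ρ₂) = p.δ := mul_div_cancel₀ _ p.ρ₂_pos.ne'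
  have hδ3 : p.ρ₃ * (p.δ / p.ρ₃) = p.δ := mul_div_cancel₀ _ p.ρ₃_pos.ne'
  have hβ3 : p.ρ₃ * (1 / (p.β * p.ρ₃)) = 1 / p.β := by
    have := p.ρ₃_pos.ne'
    field_simp
  -- All elastic and thermal couplings cancel in pairs, including the heat flux term in the `θ`
  -- equation against the `θ` source in the memory equation. Only the transport term survives.
  have key : gpInner p z w = 1 / p.β * inner ℝ (dxMem p z.2) (dxMem p ζ) := by
    rw [gpInner, inner_dxMem_add hw, h4, h7, h9, h5]
    simp only [inner_add_left, inner_add_right, inner_sub_right, inner_smul_right]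
    rw [real_inner_comm (dx (φx : L2Pair p.ℓ)) (phit z.1),
      real_inner_comm (dx (psi z.1)) (phit z.1), real_inner_comm (dx (psi w.1)) (dx (psi z.1)),
      real_inner_comm (dx (ζx : L2Pair p.ℓ)) (theta z.1),
      real_inner_comm (dx (psi w.1)) (theta z.1), real_inner_comm _ (dx (θ : L2Pair p.ℓ)),
      real_inner_comm (psit z.1) (dx (phi z.1)), real_inner_comm (psit z.1) (fn (psi z.1)),
      ibp1, ibp2, ibp3, ibp4, ibp5]
    generalize inner ℝ (dx (φx : L2Pair p.ℓ)) (phit z.1) = x₁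
    generalize inner ℝ (dx (psi z.1)) (phit z.1) = x₂
    generalize inner ℝ (dx (psi w.1)) (dx (psi z.1)) = x₃
    generalize inner ℝ (dx (ζx : L2Pair p.ℓ)) (theta z.1) = x₄
    generalize inner ℝ (dx (psi w.1)) (theta z.1) = x₅
    generalize inner ℝ (psit z.1) (dx (phi z.1)) = x₆
    generalize inner ℝ (psit z.1) (fn (psi z.1)) = x₇
    generalize inner ℝ (dxMem p z.2) (dxMem p ζ) = x₈
    linear_combination (x₁ + x₂) * hκ - x₃ * hb - (x₆ + x₇) * hκ2 + x₅ * hδ + x₄ * hβ3 - x₅ * hδ3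
  rw [key]
  linarith

end Energy

/-! ### Exponential decay -/

section Decay

theorem hasDerivAt_exp_mul (c t : ℝ) :
    HasDerivAt (fun t => Real.exp (c * t)) (c * Real.exp (c * t)) t := by
  have h : HasDerivAt (fun t => c * t) c t := by
    simpa using (hasDerivAt_id t).const_mul c
  simpa [mul_comm] using h.exp

/-- A Grönwall estimate with an exponentially decaying source. -/
theorem le_of_deriv_le_of_source_le {F F' e : ℝ → ℝ} {a r C N : ℝ} (ha : 0 < a)
    (hF : ContinuousOn F (Ici 0)) (hF' : ∀ t, 0 ≤ t → HasDerivWithinAt F (F' t) (Ici t) t)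
    (hle : ∀ t, 0 ≤ t → F' t ≤ -a * (F t - e t))
    (he : ∀ t, 0 ≤ t → e t ≤ (C * Real.exp (-r * t) * N) ^ 2) (hF0 : F 0 = N ^ 2)
    {t : ℝ} (ht : 0 ≤ t) :
    F t ≤ ((1 + 2 * C ^ 2) * Real.exp (-(min r (a / 4)) * t) * N) ^ 2 := by
  -- Capping the rate at `a / 4` keeps `c = a - 2k ≥ a / 2`. This excludes resonance between the
  -- source and the damping and gives `a / c ≤ 2`, the origin of the factor `2 * C ^ 2`.
  set k := min r (a / 4) with hk
  have hkr : k ≤ r := min_le_left _ _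
  have hka : k ≤ a / 4 := min_le_right _ _
  set c := a - 2 * k with hc
  have hc0 : 0 < c := by linarith
  have hexp : ∀ s, Real.exp (a * s) * Real.exp (-k * s) ^ 2 = Real.exp (c * s) := fun s => by
    rw [← Real.exp_nat_mul, ← Real.exp_add]
    congr 1
    push_cast
    rw [hc]
    ring
  have hsrc : ∀ s, 0 ≤ s → Real.exp (a * s) * e s ≤ C ^ 2 * N ^ 2 * Real.exp (c * s) := by
    intro s hs
    have h1 : Real.exp (-r * s) ≤ Real.exp (-k * s) := Real.exp_le_exp.2 (by nlinarith)
    have h2 : e s ≤ C ^ 2 * N ^ 2 * Real.exp (-k * s) ^ 2 := by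
      refine (he s hs).trans ?_
      rw [mul_pow, mul_pow, mul_right_comm]
      gcongr
    calc Real.exp (a * s) * e s
        ≤ Real.exp (a * s) * (C ^ 2 * N ^ 2 * Real.exp (-k * s) ^ 2) := by gcongr
      _ = C ^ 2 * N ^ 2 * Real.exp (c * s) := by rw [← hexp]; ring
  -- With the integrating factor `exp (a s)`, the derivative is at most `a exp (a s) e(s)`, hence at
  -- most that of the explicit bound `B`.
  have hmain := image_le_of_deriv_right_le_deriv_boundary
    (f := fun s => Real.exp (a * s) * F s)
    (f' := fun s => a * Real.exp (a * s) * F s + Real.exp (a * s) * F' s)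
    (B := fun s => N ^ 2 + a * C ^ 2 * N ^ 2 / c * Real.exp (c * s))
    (B' := fun s => a * C ^ 2 * N ^ 2 / c * (c * Real.exp (c * s))) (a := 0) (b := t)
    ((Continuous.continuousOn (by fun_prop)).mul (hF.mono Icc_subset_Ici_self))
    (fun s hs => ((hasDerivAt_exp_mul a s).hasDerivWithinAt).mul (hF' s hs.1))
    (by
      have : 0 ≤ a * C ^ 2 * N ^ 2 / c := by positivity
      simpa [hF0] using this)
    (Continuous.continuousOn (by fun_prop))
    (fun s _ => (((hasDerivAt_exp_mul c s).const_mul _).const_add _).hasDerivWithinAt)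
    (fun s hs => by
      have h1 := hsrc s hs.1
      have h2 := mul_le_mul_of_nonneg_left (hle s hs.1) (Real.exp_pos (a * s)).le
      have h3 : a * C ^ 2 * N ^ 2 / c * (c * Real.exp (c * s)) =
          a * (C ^ 2 * N ^ 2 * Real.exp (c * s)) := by field_simp
      have h4 := mul_le_mul_of_nonneg_left h1 ha.le
      rw [h3]
      linarith)
    ⟨ht, le_rfl⟩
  have h1 : 1 ≤ Real.exp (c * t) := Real.one_le_exp (by positivity)
  have h2 : a * C ^ 2 * N ^ 2 / c ≤ 2 * C ^ 2 * N ^ 2 := by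
    rw [div_le_iff₀ hc0]
    have : 0 ≤ C ^ 2 * N ^ 2 := by positivity
    nlinarith
  have h3 : Real.exp (a * t) * F t ≤ (1 + 2 * C ^ 2) * N ^ 2 * Real.exp (c * t) := by
    refine hmain.trans ?_
    have h4 : N ^ 2 ≤ N ^ 2 * Real.exp (c * t) := le_mul_of_one_le_right (sq_nonneg _) h1
    have h5 := mul_le_mul_of_nonneg_right h2 (Real.exp_pos (c * t)).le
    linarith
  rw [← hexp, mul_left_comm] at h3
  have h4 : F t ≤ (1 + 2 * C ^ 2) * N ^ 2 * Real.exp (-k * t) ^ 2 :=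
    le_of_mul_le_mul_left h3 (Real.exp_pos (a * t))
  refine h4.trans ?_
  -- The constant is at least one, so it may be replaced by its square; this avoids a square root in
  -- the final constant.
  have h5 : 1 + 2 * C ^ 2 ≤ (1 + 2 * C ^ 2) ^ 2 := by nlinarith [sq_nonneg C]
  rw [mul_pow, mul_pow, mul_right_comm]
  gcongr

theorem IsGenerator.hasDerivWithinAt_norm_sq {X F : Type*} [NormedAddCommGroup X]
    [NormedSpace ℝ X] [NormedAddCommGroup F] [InnerProductSpace ℝ F] {S : ℝ≥0 → X →L[ℝ] X}
    {G : X → X → Prop} (hS : IsC0Semigroup S) (hG : IsGenerator S G) {z w : X} (h : G z w)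
    {t : ℝ} (ht : 0 ≤ t) (L : X →L[ℝ] F) (c : ℝ) :
    HasDerivWithinAt (fun s : ℝ => c * ‖L (S s.toNNReal z)‖ ^ 2)
      (2 * (c * inner ℝ (L (S t.toNNReal z)) (L (S t.toNNReal w)))) (Ici t) t := by
  refine (((L.hasFDerivAt.comp_hasDerivWithinAt t
    (hG.hasDerivWithinAt hS h ht)).norm_sq).const_mul c).congr_deriv ?_
  rw [mul_left_comm]
  rfl

variable {p : Params}

theorem hasDerivWithinAt_gpNorm_sq {S : ℝ≥0 → GPSpace p →L[ℝ] GPSpace p}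
    (hS : IsC0Semigroup (X := GPSpace p) S)
    (hG : IsGenerator (X := GPSpace p) S (gpGraph p)) {z w : GPSpace p} (h : gpGraph p z w) {t : ℝ}
    (ht : 0 ≤ t) : HasDerivWithinAt (fun s : ℝ => gpNorm p (S s.toNNReal z) ^ 2)
      (2 * gpInner p (S t.toNNReal z) (S t.toNNReal w)) (Ici t) t := by
  have key := fun (L : Phase5 p →L[ℝ] L2 p.ℓ) => hG.hasDerivWithinAt_norm_sq hS h ht
    (L.comp (ContinuousLinearMap.fst ℝ _ _))
  have keyM := hG.hasDerivWithinAt_norm_sq hS h ht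
    ((dxMem p).comp (ContinuousLinearMap.snd ℝ (Phase5 p) (Mem p))) (1 / p.β)
  simp only [gpNorm_sq_eq, gpInner_eq, mul_add]
  exact (((((key (strainL p) p.κ).fun_add (key (phitL p) p.ρ₁)).fun_add
    (key (dxpsiL p) p.b)).fun_add (key (psitL p) p.ρ₂)).fun_add
    (key (thetaL p) p.ρ₃)).fun_add keyM

theorem flux_fst (z : GPSpace p) : (flux p z).1 = z.1 := by
  rw [flux_apply]

/-- The flux map intertwines the two semigroups. -/
theorem flux_semigroup {S : ℝ≥0 → GPSpace p →L[ℝ] GPSpace p}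
    (hS : IsC0Semigroup (X := GPSpace p) S)
    (hSgen : IsGenerator (X := GPSpace p) S (gpGraph p)) {R : ℝ≥0 → CatSpace p →L[ℝ] CatSpace p}
    (hR : IsC0Semigroup (X := CatSpace p) R)
    (hRgen : IsGenerator (X := CatSpace p) R (catGraph p)) (t : ℝ≥0) (z : GPSpace p) :
    flux p (S t z) = R t (flux p z) :=
  hSgen.intertwine hS hR hRgen (flux p) (fun _ _ h => gpGraph.catGraph_flux h) t z

/-- Stability of the Cattaneo system controls the energy of the Gurtin-Pipkin system. -/
theorem energy_le_of_stable {S : ℝ≥0 → GPSpace p →L[ℝ] GPSpace p}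
    (hS : IsC0Semigroup (X := GPSpace p) S)
    (hSgen : IsGenerator (X := GPSpace p) S (gpGraph p)) {R : ℝ≥0 → CatSpace p →L[ℝ] CatSpace p}
    (hR : IsC0Semigroup (X := CatSpace p) R)
    (hRgen : IsGenerator (X := CatSpace p) R (catGraph p)) {r C : ℝ} (hC : 0 ≤ C)
    (hdecay : ∀ (t : ℝ≥0) (x : CatSpace p),
      catNorm p (R t x) ≤ C * Real.exp (-r * t) * catNorm p x) (t : ℝ≥0) (z : GPSpace p) :
    Phase5.energy (S t z).1 ≤ (C * Real.exp (-r * t) * gpNorm p z) ^ 2 := by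
  have h1 := energy_le_catNorm_sq (flux p (S t z))
  rw [flux_fst] at h1
  refine h1.trans ?_
  rw [flux_semigroup hS hSgen hR hRgen]
  refine pow_le_pow_left₀ (Real.sqrt_nonneg _) ((hdecay t (flux p z)).trans ?_) 2
  exact mul_le_mul_of_nonneg_left (catNorm_flux_le z) (by positivity)

theorem continuous_gpNorm_sq_orbit {S : ℝ≥0 → GPSpace p →L[ℝ] GPSpace p}
    (hS : IsC0Semigroup (X := GPSpace p) S) (z : GPSpace p) :
    Continuous fun s : ℝ => gpNorm p (S s.toNNReal z) ^ 2 :=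
  ((continuous_gpNorm p).comp ((hS.continuous_orbit z).comp continuous_real_toNNReal)).pow 2

theorem gpInner_orbit_le {S : ℝ≥0 → GPSpace p →L[ℝ] GPSpace p}
    (hS : IsC0Semigroup (X := GPSpace p) S)
    (hSgen : IsGenerator (X := GPSpace p) S (gpGraph p)) {z w : GPSpace p} (h : gpGraph p z w)
    (t : ℝ≥0) : 2 * gpInner p (S t z) (S t w) ≤ -(p.β / p.τ) * (gpNorm p (S t z) ^ 2 -
      Phase5.energy (S t z).1) := by
  have h := gpGraph.gpInner_le (hSgen.map hS h t)
  rw [gpNorm_sq, add_sub_cancel_left]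
  exact h

theorem isClosed_gpNorm_le (T : GPSpace p →L[ℝ] GPSpace p) (c : ℝ) :
    IsClosed {x : GPSpace p | gpNorm p (T x) ≤ c * gpNorm p x} :=
  isClosed_le ((continuous_gpNorm p).comp T.continuous)
    (continuous_const.mul (continuous_gpNorm p))

end Decay

end Timoshenko

end

/-! ### Transfer of exponential stability -/

open Timoshenko in
theorem mainTheorem5 (p : Timoshenko.Params)
    (S : ℝ≥0 → Timoshenko.GPSpace p →L[ℝ] Timoshenko.GPSpace p)
    (hS : Timoshenko.IsC0Semigroup (X := Timoshenko.GPSpace p) S)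
    (hSgen : Timoshenko.IsGenerator (X := Timoshenko.GPSpace p) S (Timoshenko.gpGraph p))
    (Shat : ℝ≥0 → Timoshenko.CatSpace p →L[ℝ] Timoshenko.CatSpace p)
    (hShat : Timoshenko.IsC0Semigroup (X := Timoshenko.CatSpace p) Shat)
    (hShatgen : Timoshenko.IsGenerator (X := Timoshenko.CatSpace p) Shat (Timoshenko.catGraph p))
    (hstable : Timoshenko.ExpStable (Timoshenko.catNorm p) Shat) :
    Timoshenko.ExpStable (Timoshenko.gpNorm p) S := by
  obtain ⟨r, hr, C, hC, hdecay⟩ := hstable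
  have ha : 0 < p.β / p.τ := div_pos p.β_pos p.τ_pos
  have hC0 : 0 ≤ C := zero_le_one.trans hC
  refine ⟨min r (p.β / p.τ / 4), lt_min hr (by positivity), 1 + 2 * C ^ 2,
    by nlinarith [sq_nonneg C], fun t x => ?_⟩
  -- At fixed `t` the estimate is a closed condition on the initial datum, so the dense domain
  -- suffices; there the orbit is differentiable from the right.
  refine (isClosed_gpNorm_le (S t) _).closure_subset_iff.2 ?_ (hSgen.dense_domain hS x)
  rintro z ⟨w, hzw⟩
  have hmain := le_of_deriv_le_of_source_le ha (continuous_gpNorm_sq_orbit hS z).continuousOn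
    (fun s hs => hasDerivWithinAt_gpNorm_sq hS hSgen hzw hs)
    (fun s _ => gpInner_orbit_le hS hSgen hzw s.toNNReal)
    (fun s hs => by
      have h := energy_le_of_stable hS hSgen hShat hShatgen hC0 hdecay s.toNNReal z
      rwa [Real.coe_toNNReal s hs] at h)
    (by rw [Real.toNNReal_zero, hS.zero, ContinuousLinearMap.id_apply]) t.coe_nonneg
  rw [Real.toNNReal_coe] at hmain
  have hN : 0 ≤ gpNorm p z := Real.sqrt_nonneg _
  exact (sq_le_sq₀ (Real.sqrt_nonneg _) (by positivity)).1 hmain
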